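/- Let $\Omega=(-1,1)$, $k\in\mathbb N=\{1,2,\dots\}$, and let $u:[-1,1]\to\mathbb R$ be such that $u,u',\dots,u^{(k-1)}$ exist on $[-1,1]$ and are absolutely continuous there; then $u^{(k)}$ exists almost everywhere and is integrable. Let $P_n$ be the Legendre polynomial of degree $n$ with $P_n(1)=1$, and $$\hat u_n=\frac{2n+1}{2}\int_{-1}^1u(x)P_n(x)\,dx,\qquad (\pi_Nu)(x)=\sum_{n=0}^N\hat u_nP_n(x).$$ For $\theta\in(-1,1)$ and $\mu\in(k-1,k)$ the Caputo fractional derivatives of $u$ at $\theta$ are $$({}^C\!D_{\theta+}^{\mu}u)(x)=\frac1{\Gamma(k-\mu)}\int_\theta^x\frac{u^{(k)}(y)}{(x-y)^{1-k+\mu}}\,dy\quad(\theta<x\le 1),\qquad ({}^C\!D_{\theta-}^{\mu}u)(x)=\frac{(-1)^k}{\Gamma(k-\mu)}\int_x^\theta\frac{u^{(k)}(y)}{(y-x)^{1-k+\mu}}\,dy\quad(-1\le x<\theta).$$ They, and $u^{(k)}$, are defined almost everywhere only. We write $f\in\mathrm{BV}([a,b])$ if $f$ agrees almost everywhere on $[a,b]$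 with a function $g$ of bounded variation on $[a,b]$; the total variation $V_{[a,b]}[f]$ and the one-sided limits $f(\theta\pm)$ are those of $g$, and the statements below hold for every choice of such a $g$. For $\mu>0$ and $N\in\mathbb N$ with $N\ge\mu$ put $$C_{\mu,N}=\frac{1}{2^{\mu-1}(\mu-\frac12)\sqrt\pi}\,\frac{\Gamma((N-\mu+1)/2)}{\Gamma((N+\mu)/2)}\quad(\mu>\tfrac12),\qquad C^*_{\mu,N}=\frac{1}{2^{\mu-1}\mu\,\pi}\,\frac{\Gamma((N-\mu+1)/2)}{\Gamma((N+\mu+1)/2)} .$$ (i) Let $\mu\in(k-1,k)$, $\theta\in(-1,1)$, ${}^C\!D_{\theta+}^{\mu}u\in\mathrm{BV}([\theta,1])$ and ${}^C\!D_{\theta-}^{\mu}u\in\mathrm{BV}([-1,\theta])$, and put $$U_\theta^{(\mu)}=V_{[-1,\theta]}[{}^C\!D_{\theta-}^{\mu}u]+V_{[\theta,1]}[{}^C\!D_{\theta+}^{\mu}u]+|({}^C\!D_{\theta-}^{\mu}u)(\theta-)|+|({}^C\!D_{\theta+}^{\mu}u)(\theta+)|.$$ If $\mu>\frac12$, then $\|u-\pi_Nu\|_{L^\infty(\Omega)}\le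 C_{\mu,N}\,U_\theta^{(\mu)}$ for all integers $N\ge\mu$; and, without the restriction $\mu>\frac12$, $\|(1-x^2)^{1/4}(u-\pi_Nu)\|_{L^\infty(\Omega)}\le C^*_{\mu,N}\,U_\theta^{(\mu)}$ for all integers $N\ge\mu$. Moreover, as $N\to\infty$, both $C_{\mu,N}$ and $\|u-\pi_Nu\|_{L^\infty(\Omega)}$ are $O(N^{-\mu+1/2})$ if $\mu>\frac12$, and both $C^*_{\mu,N}$ and $\|(1-x^2)^{1/4}(u-\pi_Nu)\|_{L^\infty(\Omega)}$ are $O(N^{-\mu})$. (ii) If $u^{(k)}\in\mathrm{BV}([-1,1])$, then the same bounds (for all integers $N\ge k$) and the same rates hold with $\mu=k$ and with $V_{[-1,1]}[u^{(k)}]$ in place of $U_\theta^{(\mu)}$. -/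

import Mathlib

open Set Filter Topology MeasureTheory Asymptotics
open scoped ENNReal

noncomputable section

/-- The Legendre polynomial of degree `n`, normalised by `P_n(1) = 1` (Rodrigues' formula). -/
def legendreP (n : ℕ) : Polynomial ℝ :=
  Polynomial.C (1 / (2 ^ n * (n.factorial : ℝ))) *
    Polynomial.derivative^[n] ((Polynomial.X ^ 2 - 1) ^ n)

/-- The Legendre expansion coefficient `(2n+1)/2 * ∫_{-1}^{1} u(x) P_n(x) dx`. -/
def legendreCoeff (u : ℝ → ℝ) (n : ℕ) : ℝ :=
  (2 * (n : ℝ) + 1) / 2 * ∫ x in (-1 : ℝ)..1, u x * (legendreP n).eval x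

/-- The `L²`-orthogonal projection of `u` onto polynomials of degree at most `N`. -/
def legendreProj (N : ℕ) (u : ℝ → ℝ) (x : ℝ) : ℝ :=
  ∑ n ∈ Finset.range (N + 1), legendreCoeff u n * (legendreP n).eval x

/-- The `L^∞(-1,1)`-norm, as an extended nonnegative real. -/
def supNorm (f : ℝ → ℝ) : ℝ≥0∞ :=
  eLpNorm f ∞ (volume.restrict (Ioo (-1 : ℝ) 1))

/-- The projection error `u - π_N u`. -/
def projError (N : ℕ) (u : ℝ → ℝ) (x : ℝ) : ℝ :=
  u x - legendreProj N u x

/-- The weighted projection error `(1 - x²)^{1/4} (u - π_N u)`. -/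
def weightedProjError (N : ℕ) (u : ℝ → ℝ) (x : ℝ) : ℝ :=
  (1 - x ^ 2) ^ (1 / 4 : ℝ) * projError N u x

/-- The derivative `u^{(j)}` on `[-1, 1]` (one-sided at the endpoints). When `u^{(j-1)}` is only
absolutely continuous this is meaningful almost everywhere. -/
def derivOn (j : ℕ) (u : ℝ → ℝ) : ℝ → ℝ :=
  iteratedDerivWithin j u (Icc (-1 : ℝ) 1)

/-- `u, u', …, u^{(k-1)}` exist on `[-1, 1]` and are absolutely continuous there. -/
def ACDerivs (k : ℕ) (u : ℝ → ℝ) : Prop :=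
  (∀ j : ℕ, j + 1 < k → DifferentiableOn ℝ (derivOn j u) (Icc (-1 : ℝ) 1)) ∧
  ∀ j : ℕ, j < k → AbsolutelyContinuousOnInterval (derivOn j u) (-1) 1

/-- The left-sided Riemann–Liouville fractional integral `(I_{a+}^ρ f)(x)` of order `ρ > 0`,
for `x > a`. -/
def rlIntegralLeft (ρ a : ℝ) (f : ℝ → ℝ) (x : ℝ) : ℝ :=
  1 / Real.Gamma ρ * ∫ y in a..x, f y / (x - y) ^ (1 - ρ)

/-- The right-sided Riemann–Liouville fractional integral `(I_{b-}^ρ f)(x)` of order `ρ > 0`,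
for `x < b`. -/
def rlIntegralRight (ρ b : ℝ) (f : ℝ → ℝ) (x : ℝ) : ℝ :=
  1 / Real.Gamma ρ * ∫ y in x..b, f y / (y - x) ^ (1 - ρ)

/-- The left-sided Caputo derivative `ᶜD_{θ+}^μ u = I_{θ+}^{k-μ} u^{(k)}`, `k - 1 < μ < k`,
of a function `u` on `[-1, 1]`. -/
def caputoLeft (k : ℕ) (μ θ : ℝ) (u : ℝ → ℝ) (x : ℝ) : ℝ :=
  rlIntegralLeft ((k : ℝ) - μ) θ (derivOn k u) x

/-- The right-sided Caputo derivative `ᶜD_{θ-}^μ u = (-1)^k I_{θ-}^{k-μ} u^{(k)}`,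
`k - 1 < μ < k`, of a function `u` on `[-1, 1]`. -/
def caputoRight (k : ℕ) (μ θ : ℝ) (u : ℝ → ℝ) (x : ℝ) : ℝ :=
  (-1) ^ k * rlIntegralRight ((k : ℝ) - μ) θ (derivOn k u) x

/-- `g` is a representative of `f` on `[a, b]` (equal to it almost everywhere) that has bounded
variation on `[a, b]`. The functions `f` it is used for (fractional integrals of integrable
functions, derivatives of absolutely continuous functions) are defined almost everywhere only. -/
def IsBVRep (g f : ℝ → ℝ) (a b : ℝ) : Prop :=
  g =ᵐ[volume.restrict (Icc a b)] f ∧ BoundedVariationOn g (Icc a b)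

/-- The total variation of `g` on `[a, b]` (for `g` of bounded variation). -/
def totalVar (g : ℝ → ℝ) (a b : ℝ) : ℝ :=
  (eVariationOn g (Icc a b)).toReal

/-- `V_{[-1,θ]}[Dm] + V_{[θ,1]}[Dp] + |Dm(θ-)| + |Dp(θ+)|`. -/
def fracSeminorm (Dm Dp : ℝ → ℝ) (θ : ℝ) : ℝ :=
  totalVar Dm (-1) θ + totalVar Dp θ 1 + |Function.leftLim Dm θ| + |Function.rightLim Dp θ|

/-- The constant of the `L^∞`-estimate. -/
def truncConst (μ : ℝ) (N : ℕ) : ℝ :=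
  1 / (2 ^ (μ - 1) * (μ - 1 / 2) * √Real.pi) *
    (Real.Gamma (((N : ℝ) - μ + 1) / 2) / Real.Gamma (((N : ℝ) + μ) / 2))

/-- The constant of the weighted `L^∞`-estimate. -/
def weightedTruncConst (μ : ℝ) (N : ℕ) : ℝ :=
  1 / (2 ^ (μ - 1) * μ * Real.pi) *
    (Real.Gamma (((N : ℝ) - μ + 1) / 2) / Real.Gamma (((N : ℝ) + μ + 1) / 2))

end

/-!
The series tail `u - π_N u = ∑_{n > N} û_n P_n` is estimated term by term, so everything rests on a
bound for `∫ u P_n` with the right constant.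

*Coefficients.* Rodrigues' formula exhibits the `j`-fold antiderivatives of `P_n` that vanish at
`±1`, so integrating by parts `k` times turns `∫ u P_n` into the integral of `u^{(k)}` against the
`k`-fold integral `I^k P_n`, based at `1`
(`integral_mul_legendreP_eq_integral_fracPoly`). With `I^k = I^{k-μ} I^μ`, Fubini's theorem and the
Beta integral move `I^{k-μ}` onto `u^{(k)}`, where it produces the Caputo derivative
(`abs_integral_mul_fracPoly_le`); the part of the interval to the left of `θ` is treated by the
reflection `x ↦ -x`. Pairing a function of bounded variation with `I^μ P_n` costs only the supremum
of the tail integrals, which are values of `I^{μ+1} P_n`; this is a second mean value theorem,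
proved by a Jordan decomposition and the layer-cake formula (`abs_integral_sub_mul_le_totalVar`).

*Fractional integrals of `P_n`.* In the variable `t = 1 - x` the function `w = I^s P_n` is a finite
sum of powers of `t` (`fracPoly`) and solves a Gegenbauer equation. Its Sonin function
`w² + (2t - t²) w'² / l` is largest at the midpoint if `s > 1/2`. There `w` and `w'` are known in
closed form, and after the reflection formula for `Γ` and the inequalities
`(z - 1/2) Γ(z)² ≤ Γ(z + 1/2)² ≤ z Γ(z)²` the two terms carry `sin²` and `cos²` of the same angle,
so they add up (`sq_fracPoly_legendreT_le`). The same device gives `|P_n| ≤ 1` and, for the weighted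
estimate, Bernstein's inequality (`sqrt_mul_sq_legendreP_le`).

*Summation.* The resulting bounds for the terms are quotients `Γ(y) / Γ(y + 1 + δ)` with `y` in
steps of `1/2`, and `Γ(y) / Γ(y + δ) - Γ(y + 1) / Γ(y + 1 + δ) = δ Γ(y) / Γ(y + 1 + δ)`, so the sum
telescopes (`sum_Gamma_div_Gamma_le`) to exactly the stated constants. No pointwise convergence of
the Legendre series is needed: a bound for all partial sums of the tail passes to `u - π_N u` almost
everywhere because `π_M u → u` in `L²` (`ae_weighted_projError_le`). The rates follow from the
log-convexity of `Γ` (`isBigO_gammaQuot`).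
-/

/-! ### Algebra of Legendre polynomials -/

section LegendreAlgebra

open Polynomial

/-- The polynomials `(1 / (2^n n!)) D^{n-j} (x² - 1)^n`. For `j = 0` this is the Legendre polynomial
of degree `n`; for `j ≤ n` it is its `j`-fold antiderivative that vanishes to order `j` at `±1`. -/
noncomputable def legendreAntideriv (n j : ℕ) : ℝ[X] :=
  C (1 / (2 ^ n * (n.factorial : ℝ))) * derivative^[n - j] ((X ^ 2 - 1) ^ n)

theorem legendreAntideriv_zero (n : ℕ) : legendreAntideriv n 0 = legendreP n := rfl

theorem derivative_legendreAntideriv {n j : ℕ} (h : j + 1 ≤ n) :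
    derivative (legendreAntideriv n (j + 1)) = legendreAntideriv n j := by
  have h1 : n - j = (n - (j + 1)) + 1 := by omega
  simp only [legendreAntideriv, h1, derivative_C_mul, Function.iterate_succ_apply']

theorem eval_legendreAntideriv_of_sq_eq_one {n j : ℕ} (h1 : 1 ≤ j) (h2 : j ≤ n) {x : ℝ}
    (hx : x ^ 2 = 1) : (legendreAntideriv n j).eval x = 0 := by
  have h3 : (X ^ 2 - 1 : ℝ[X]) ∣ derivative^[n - j] ((X ^ 2 - 1) ^ n) :=
    (dvd_pow_self _ (by omega : n - (n - j) ≠ 0)).trans (pow_sub_dvd_iterate_derivative_pow _ _ _)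
  obtain ⟨q, hq⟩ := h3
  simp [legendreAntideriv, hq, hx]

theorem iterate_derivative_comp_neg_X (p : ℝ[X]) (m : ℕ) :
    (derivative^[m] p).comp (-X) = (-1) ^ m * derivative^[m] (p.comp (-X)) := by
  induction m generalizing p with
  | zero => simp
  | succ m ih =>
    rw [Function.iterate_succ_apply, ih, Function.iterate_succ_apply, derivative_comp]
    simp [pow_succ]

theorem eval_neg_legendreAntideriv {n j : ℕ} (h : j ≤ n) (x : ℝ) :
    (legendreAntideriv n j).eval (-x) = (-1) ^ (n + j) * (legendreAntideriv n j).eval x := by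
  have h1 := congrArg (eval x) (iterate_derivative_comp_neg_X ((X ^ 2 - 1) ^ n) (n - j))
  have h2 : ((X ^ 2 - 1 : ℝ[X]) ^ n).comp (-X) = (X ^ 2 - 1) ^ n := by simp
  have h3 : (-1 : ℝ) ^ (n + j) = (-1) ^ (n - j) := by
    rw [show n + j = (n - j) + 2 * j by omega, pow_add, pow_mul]; simp
  rw [h2] at h1
  simp only [eval_comp, eval_neg, eval_X, eval_mul, eval_pow, eval_one] at h1
  simp only [legendreAntideriv, eval_mul, eval_C, h1, h3]
  ring

theorem legendreP_zero : legendreP 0 = 1 := by simp [legendreP]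

theorem legendreP_one : legendreP 1 = X := by
  simp [legendreP]
  rw [one_add_one_eq_two, show (2 : ℝ[X]) = C 2 by rfl, ← mul_assoc, ← C_mul]
  norm_num

/-- `P_{n+1}' = x P_n' + (n+1) P_n`. -/
theorem derivative_legendreP_succ (n : ℕ) :
    derivative (legendreP (n + 1)) =
      X * derivative (legendreP n) + C ((n : ℝ) + 1) * legendreP n := by
  have h1 : derivative ((X ^ 2 - 1 : ℝ[X]) ^ (n + 1)) =
      C (2 * ((n : ℝ) + 1)) * (X * (X ^ 2 - 1) ^ n) := by
    simp [derivative_pow]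
    ring
  have h2 : derivative^[n + 2] ((X ^ 2 - 1 : ℝ[X]) ^ (n + 1)) =
      C (2 * ((n : ℝ) + 1)) * (X * derivative^[n + 1] ((X ^ 2 - 1) ^ n) +
        C ((n : ℝ) + 1) * derivative^[n] ((X ^ 2 - 1) ^ n)) := by
    rw [Function.iterate_succ_apply, h1, iterate_derivative_C_mul, mul_comm X,
      iterate_derivative_mul_X]
    simp only [nsmul_eq_mul, map_mul, map_add, map_natCast, map_one, Nat.cast_add, Nat.cast_one,
      Nat.add_sub_cancel]
    ring
  have h3 : (1 / (2 ^ (n + 1) * ((n + 1).factorial : ℝ))) * (2 * ((n : ℝ) + 1)) =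
      1 / (2 ^ n * (n.factorial : ℝ)) := by
    rw [Nat.factorial_succ]
    have := Nat.factorial_ne_zero n
    push_cast
    field_simp
    ring
  simp only [legendreP, derivative_C_mul, ← Function.iterate_succ_apply' derivative]
  rw [h2, ← mul_assoc, ← C_mul, h3]
  ring

/-- `P_{n+1}' - P_{n-1}' = (2n+1) P_n`. -/
theorem derivative_legendreP_add_two (n : ℕ) :
    derivative (legendreP (n + 2)) =
      derivative (legendreP n) + C (2 * (n : ℝ) + 3) * legendreP (n + 1) := by
  have h1 : derivative (derivative ((X ^ 2 - 1 : ℝ[X]) ^ (n + 2))) =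
      C (4 * ((n : ℝ) + 2) * (n + 1)) * (X ^ 2 - 1) ^ n +
        C (2 * ((n : ℝ) + 2) * (2 * n + 3)) * (X ^ 2 - 1) ^ (n + 1) := by
    simp only [derivative_pow, derivative_mul, derivative_sub, derivative_one, derivative_X,
      derivative_natCast, derivative_zero, map_mul, map_add, map_natCast, map_one, C_ofNat]
    simp only [Nat.add_sub_cancel, show n + 2 - 1 = n + 1 by rfl]
    push_cast
    ring
  have h2 : derivative^[n + 3] ((X ^ 2 - 1 : ℝ[X]) ^ (n + 2)) =
      C (4 * ((n : ℝ) + 2) * (n + 1)) * derivative^[n + 1] ((X ^ 2 - 1) ^ n) +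
        C (2 * ((n : ℝ) + 2) * (2 * n + 3)) * derivative^[n + 1] ((X ^ 2 - 1) ^ (n + 1)) := by
    rw [show n + 3 = (n + 1) + 1 + 1 by ring, Function.iterate_succ_apply,
      Function.iterate_succ_apply, h1, iterate_map_add, iterate_derivative_C_mul,
      iterate_derivative_C_mul]
  have h3 : (1 / (2 ^ (n + 2) * ((n + 2).factorial : ℝ))) * (4 * ((n : ℝ) + 2) * (n + 1)) =
      1 / (2 ^ n * (n.factorial : ℝ)) := by
    rw [Nat.factorial_succ, Nat.factorial_succ]
    have := Nat.factorial_ne_zero n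
    push_cast
    field_simp
    ring
  have h4 : (1 / (2 ^ (n + 2) * ((n + 2).factorial : ℝ))) * (2 * ((n : ℝ) + 2) * (2 * n + 3)) =
      (2 * n + 3) * (1 / (2 ^ (n + 1) * ((n + 1).factorial : ℝ))) := by
    rw [Nat.factorial_succ (n + 1)]
    have := Nat.factorial_ne_zero (n + 1)
    push_cast
    field_simp
    ring
  simp only [legendreP, derivative_C_mul, ← Function.iterate_succ_apply' derivative]
  rw [h2, mul_add, ← mul_assoc, ← C_mul, h3, ← mul_assoc, ← C_mul, h4, C_mul]
  ring

/-- `x (P_{n+2} - P_n)' = (n+2) P_{n+2} + (n+1) P_n`. -/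
theorem X_mul_derivative_legendreP_sub (n : ℕ) :
    X * derivative (legendreP (n + 2) - legendreP n) =
      C ((n : ℝ) + 2) * legendreP (n + 2) + C ((n : ℝ) + 1) * legendreP n := by
  have h1 := derivative_legendreP_succ (n + 2)
  have h2 := derivative_legendreP_add_two (n + 1)
  have h3 := derivative_legendreP_succ n
  push_cast at h1 h2
  rw [derivative_sub]
  simp only [map_add, map_mul, C_ofNat, map_natCast, map_one] at *
  linear_combination h2 - h1 + h3

/-- `(1 - x²) P_{n+1}' = (n+1) (P_n - x P_{n+1})`. -/
theorem one_sub_X_sq_mul_derivative_legendreP_succ (n : ℕ) :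
    (1 - X ^ 2) * derivative (legendreP (n + 1)) =
      C ((n : ℝ) + 1) * (legendreP n - X * legendreP (n + 1)) := by
  have h1 := derivative_legendreP_succ (n + 1)
  have h2 := derivative_legendreP_add_two n
  have h3 := derivative_legendreP_succ n
  push_cast at h1
  simp only [map_add, map_mul, C_ofNat, map_natCast, map_one] at *
  linear_combination X * h1 - X * h2 + h3

/-- Legendre's differential equation `(1 - x²) P_n'' - 2 x P_n' + n (n+1) P_n = 0`. -/
theorem legendreP_ode (n : ℕ) :
    (1 - X ^ 2) * derivative (derivative (legendreP n)) - 2 * X * derivative (legendreP n) +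
      C ((n : ℝ) * (n + 1)) * legendreP n = 0 := by
  cases n with
  | zero => simp [legendreP_zero]
  | succ n =>
    have h1 := congrArg derivative (one_sub_X_sq_mul_derivative_legendreP_succ n)
    have h2 := derivative_legendreP_succ (n + 1)
    have h3 := derivative_legendreP_add_two n
    push_cast at *
    simp only [derivative_mul, derivative_sub, derivative_one, derivative_X, derivative_X_pow,
      derivative_natCast, map_add, map_mul, C_ofNat, map_natCast, map_one] at *
    push_cast at h1
    linear_combination h1 + ((n : ℝ[X]) + 1) * h2 - ((n : ℝ[X]) + 1) * h3

theorem eval_one_legendreP (n : ℕ) : (legendreP n).eval 1 = 1 := by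
  induction n with
  | zero => simp [legendreP_zero]
  | succ n ih =>
    have h := congrArg (eval 1) (one_sub_X_sq_mul_derivative_legendreP_succ n)
    simp [ih] at h
    rcases h with h | h
    · linarith [n.cast_nonneg (α := ℝ)]
    · linarith

theorem eval_neg_legendreP (n : ℕ) (x : ℝ) :
    (legendreP n).eval (-x) = (-1) ^ n * (legendreP n).eval x :=
  eval_neg_legendreAntideriv n.zero_le x

theorem eval_zero_derivative_legendreP_succ (n : ℕ) :
    (derivative (legendreP (n + 1))).eval 0 = (n + 1) * (legendreP n).eval 0 := by
  have h := congrArg (eval 0) (one_sub_X_sq_mul_derivative_legendreP_succ n)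
  simpa using h

theorem natDegree_legendreP_le (n : ℕ) : (legendreP n).natDegree ≤ n := by
  refine (natDegree_C_mul_le _ _).trans ((natDegree_iterate_derivative _ _).trans ?_)
  have : ((X ^ 2 - 1 : ℝ[X]) ^ n).natDegree ≤ n * 2 :=
    natDegree_pow_le_of_le n (by compute_degree)
  omega

theorem coeff_legendreP_self_ne_zero (n : ℕ) : (legendreP n).coeff n ≠ 0 := by
  have h1 : ((X ^ 2 - 1 : ℝ[X]) ^ n).coeff (n + n) = 1 := by
    have h2 : (X ^ 2 - 1 : ℝ[X]).Monic := monic_X_pow_sub_C 1 two_ne_zero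
    have h3 : ((X ^ 2 - 1 : ℝ[X]) ^ n).natDegree = n + n := by
      rw [natDegree_pow, show (X ^ 2 - 1 : ℝ[X]) = X ^ 2 - C 1 by simp, natDegree_X_pow_sub_C]
      ring
    rw [← h3]
    exact (h2.pow n).coeff_natDegree
  rw [legendreP, coeff_C_mul, coeff_iterate_derivative, h1]
  have h4 : (n + n).descFactorial n ≠ 0 := by
    rw [Ne, Nat.descFactorial_eq_zero_iff_lt]; omega
  have := Nat.factorial_ne_zero n
  simp [h4, this]

end LegendreAlgebra

/-! ### Fractional integrals of polynomials -/

section FractionalIntegral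

open Polynomial

/-- The functional equation of `1 / Γ`, which holds at the poles of `Γ` as well. -/
theorem inv_Gamma_eq_self_mul_inv_Gamma_add_one (x : ℝ) :
    (Real.Gamma x)⁻¹ = x * (Real.Gamma (x + 1))⁻¹ := by
  rcases eq_or_ne x 0 with rfl | hx
  · simp
  · rw [Real.Gamma_add_one hx]
    field_simp

/-- The Riemann–Liouville integral of order `s`, based at `0`, of a polynomial, written out term by
term as `∑ j, p_j (j! / Γ(j + 1 + s)) t ^ (j + s)`. In this form it makes sense for every real `s`,
negative orders being derivatives. At the poles of `Γ` the convention `0⁻¹ = 0` gives the right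
value of the entire function `1 / Γ`. -/
noncomputable def fracPoly (s : ℝ) (p : ℝ[X]) (t : ℝ) : ℝ :=
  p.sum fun j c => c * ((j.factorial : ℝ) * (Real.Gamma (j + 1 + s))⁻¹ * t ^ ((j : ℝ) + s))

theorem fracPoly_add (s : ℝ) (p q : ℝ[X]) (t : ℝ) :
    fracPoly s (p + q) t = fracPoly s p t + fracPoly s q t :=
  sum_add_index p q _ (by simp) (by intros; ring)

theorem fracPoly_zero (s t : ℝ) : fracPoly s 0 t = 0 := sum_zero_index _

theorem fracPoly_monomial (s : ℝ) (j : ℕ) (a t : ℝ) : fracPoly s (monomial j a) t =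
    a * ((j.factorial : ℝ) * (Real.Gamma (j + 1 + s))⁻¹ * t ^ ((j : ℝ) + s)) :=
  sum_monomial_index a _ (by simp)

theorem fracPoly_C_mul (s a : ℝ) (p : ℝ[X]) (t : ℝ) :
    fracPoly s (C a * p) t = a * fracPoly s p t := by
  induction p using Polynomial.induction_on' with
  | add p q hp hq => rw [mul_add, fracPoly_add, hp, hq, fracPoly_add]; ring
  | monomial j b => rw [C_mul_monomial, fracPoly_monomial, fracPoly_monomial]; ring

theorem fracPoly_sub (s : ℝ) (p q : ℝ[X]) (t : ℝ) :
    fracPoly s (p - q) t = fracPoly s p t - fracPoly s q t := by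
  rw [show p - q = p + C (-1) * q by simp [sub_eq_add_neg], fracPoly_add, fracPoly_C_mul]
  ring

theorem fracPoly_order_zero (p : ℝ[X]) (t : ℝ) : fracPoly 0 p t = p.eval t := by
  induction p using Polynomial.induction_on' with
  | add p q hp hq => rw [fracPoly_add, hp, hq, eval_add]
  | monomial j b =>
    have := Nat.factorial_ne_zero j
    rw [fracPoly_monomial, eval_monomial, add_zero, add_zero, Real.Gamma_nat_eq_factorial,
      Real.rpow_natCast]
    field_simp

theorem fracPoly_at_zero {s : ℝ} (hs : 0 < s) (p : ℝ[X]) : fracPoly s p 0 = 0 := by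
  induction p using Polynomial.induction_on' with
  | add p q hp hq => rw [fracPoly_add, hp, hq, add_zero]
  | monomial j b =>
    rw [fracPoly_monomial, Real.zero_rpow (by positivity)]
    simp

theorem continuous_fracPoly {s : ℝ} (hs : 0 ≤ s) (p : ℝ[X]) : Continuous (fracPoly s p) := by
  induction p using Polynomial.induction_on' with
  | add p q hp hq => exact (hp.add hq).congr fun t => (fracPoly_add s p q t).symm
  | monomial j b =>
    simp only [funext (fracPoly_monomial s j b)]
    exact continuous_const.mul (continuous_const.mul
      (Real.continuous_rpow_const (by positivity)))

theorem hasDerivAt_fracPoly (s : ℝ) (p : ℝ[X]) {t : ℝ} (ht : 0 < t) :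
    HasDerivAt (fracPoly s p) (fracPoly (s - 1) p t) t := by
  induction p using Polynomial.induction_on' with
  | add p q hp hq =>
    rw [fracPoly_add]
    exact (hp.add hq).congr_of_eventuallyEq (.of_forall fun x => fracPoly_add s p q x)
  | monomial j b =>
    have h1 := (Real.hasDerivAt_rpow_const (p := (j : ℝ) + s) (Or.inl ht.ne')).const_mul
      (b * ((j.factorial : ℝ) * (Real.Gamma (j + 1 + s))⁻¹))
    have h2 := inv_Gamma_eq_self_mul_inv_Gamma_add_one ((j : ℝ) + s)
    rw [show (j : ℝ) + s + 1 = j + 1 + s by ring] at h2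
    refine (h1.congr_of_eventuallyEq
      (.of_forall fun x => by simp only [fracPoly_monomial]; ring)).congr_deriv ?_
    rw [fracPoly_monomial, show (j : ℝ) + 1 + (s - 1) = j + s by ring, h2,
      show (j : ℝ) + (s - 1) = j + s - 1 by ring]
    ring

/-- The fractional integral intertwines the Legendre operator, in the variable `t = 1 - x`, with a
Gegenbauer operator. -/
theorem fracPoly_legendre_operator (s c : ℝ) (p : ℝ[X]) {t : ℝ} (ht : 0 < t) :
    (2 * t - t ^ 2) * fracPoly (s - 1 - 1) p t - 2 * (s - 1) * (1 - t) * fracPoly (s - 1) p t +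
      (c + s - s ^ 2) * fracPoly s p t =
    fracPoly s ((2 * X - X ^ 2) * derivative (derivative p) + 2 * (1 - X) * derivative p +
      C c * p) t := by
  induction p using Polynomial.induction_on' with
  | add p q hp hq =>
    have h1 : (2 * X - X ^ 2) * derivative (derivative (p + q)) + 2 * (1 - X) * derivative (p + q) +
        C c * (p + q) = ((2 * X - X ^ 2) * derivative (derivative p) + 2 * (1 - X) * derivative p +
        C c * p) + ((2 * X - X ^ 2) * derivative (derivative q) + 2 * (1 - X) * derivative q +
        C c * q) := by
      rw [derivative_add, derivative_add]; ring
    rw [h1, fracPoly_add s (_ + _), ← hp, ← hq, fracPoly_add, fracPoly_add, fracPoly_add]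
    ring
  | monomial j b =>
    have h1 : (2 * X - X ^ 2) * derivative (derivative (monomial j b)) +
        2 * (1 - X) * derivative (monomial j b) + C c * monomial j b =
        monomial (j - 1) (2 * (j : ℝ) ^ 2 * b) + monomial j ((c - j * (j + 1)) * b) := by
      rcases j with _ | _ | j
      · simp [← C_mul_X_pow_eq_monomial]
      · simp [← C_mul_X_pow_eq_monomial, C_ofNat]; ring
      · simp only [← C_mul_X_pow_eq_monomial, derivative_C_mul, derivative_X_pow,
          Nat.add_sub_cancel]
        simp only [map_mul, map_sub, map_add, map_natCast, map_one, map_pow, C_ofNat]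
        push_cast
        ring
    rw [h1, fracPoly_add]
    simp only [fracPoly_monomial]
    have h2 := inv_Gamma_eq_self_mul_inv_Gamma_add_one ((j : ℝ) + s)
    have h3 := inv_Gamma_eq_self_mul_inv_Gamma_add_one ((j : ℝ) + s - 1)
    rw [show (j : ℝ) + s - 1 + 1 = j + s by ring, h2] at h3
    rw [show (j : ℝ) + s + 1 = j + 1 + s by ring] at h2 h3
    have h4 : t ^ ((j : ℝ) + s) = t ^ 2 * t ^ ((j : ℝ) + s - 2) := by
      rw [← Real.rpow_natCast, ← Real.rpow_add ht]; congr 1; push_cast; ring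
    have h5 : t ^ ((j : ℝ) + s - 1) = t * t ^ ((j : ℝ) + s - 2) := by
      nth_rewrite 2 [← Real.rpow_one t]
      rw [← Real.rpow_add ht]; congr 1; ring
    rw [show (j : ℝ) + 1 + (s - 1 - 1) = j + s - 1 by ring,
      show (j : ℝ) + 1 + (s - 1) = j + s by ring, h3, h2,
      show (j : ℝ) + (s - 1 - 1) = j + s - 2 by ring,
      show (j : ℝ) + (s - 1) = j + s - 1 by ring, h4, h5]
    rcases j with _ | j
    · simp only [Nat.cast_zero, Nat.factorial_zero, Nat.cast_one]
      ring
    · have h7 : ((j + 1 : ℕ) : ℝ) + s = j + 1 + s := by push_cast; ring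
      have h8 : (j : ℝ) + s = (j + s - 1) + 1 := by ring
      rw [h7] at h2
      simp only [Nat.add_sub_cancel, Nat.factorial_succ, h7, h2]
      rw [h8, Real.rpow_add_one ht.ne']
      push_cast
      ring_nf

/-- Evaluation at `t = 1` of `s I^s g - I^s ((1 - t) g')`: only the constant term of `g`
contributes. -/
theorem fracPoly_one_euler (s : ℝ) (g : ℝ[X]) (hg : g.eval 0 = 0) :
    s * fracPoly s g 1 = fracPoly s ((1 - X) * derivative g) 1 := by
  have key : ∀ p : ℝ[X], s * fracPoly s p 1 =
      fracPoly s ((1 - X) * derivative p) 1 + p.coeff 0 * (s * (Real.Gamma (1 + s))⁻¹) := by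
    intro p
    induction p using Polynomial.induction_on' with
    | add p q hp hq =>
      rw [derivative_add, mul_add, fracPoly_add, fracPoly_add, mul_add, hp, hq, coeff_add]
      ring
    | monomial j b =>
      rcases j with _ | j
      · rw [fracPoly_monomial]
        simp [fracPoly_zero]
        ring
      · have h1 : (1 - X) * derivative (monomial (j + 1) b) =
            monomial j ((j + 1) * b) - monomial (j + 1) ((j + 1) * b) := by
          simp only [← C_mul_X_pow_eq_monomial, derivative_C_mul, derivative_X_pow,
            Nat.add_sub_cancel, map_mul, map_add, map_natCast, map_one]
          push_cast
          ring
        have h2 := inv_Gamma_eq_self_mul_inv_Gamma_add_one ((j : ℝ) + 1 + s)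
        rw [show (j : ℝ) + 1 + s + 1 = j + 1 + 1 + s by ring] at h2
        rw [h1, fracPoly_sub, fracPoly_monomial, fracPoly_monomial, fracPoly_monomial,
          coeff_monomial, h2]
        simp only [Nat.factorial_succ, Real.one_rpow]
        push_cast
        simp
        ring
  rw [key g, coeff_zero_eq_eval_zero, hg]
  ring

end FractionalIntegral

/-! ### Inequalities for quotients of Gamma values -/

section GammaInequalities

open Real

theorem sq_Gamma_add_half_le {z : ℝ} (hz : 0 < z) : Gamma (z + 1 / 2) ^ 2 ≤ z * Gamma z ^ 2 := by
  have h := Gamma_mul_add_mul_le_rpow_Gamma_mul_rpow_Gamma hz (by linarith : 0 < z + 1)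
    (by norm_num : (0 : ℝ) < 1 / 2) (by norm_num : (0 : ℝ) < 1 / 2) (by norm_num)
  have h1 := Gamma_pos_of_pos hz
  rw [Gamma_add_one hz.ne', show 1 / 2 * z + 1 / 2 * (z + 1) = z + 1 / 2 by ring, ← sqrt_eq_rpow,
    ← sqrt_eq_rpow, ← sqrt_mul h1.le] at h
  have h2 := pow_le_pow_left₀ (Gamma_pos_of_pos (by linarith)).le h 2
  rw [sq_sqrt (by positivity)] at h2
  linarith

theorem mul_sq_Gamma_le_sq_Gamma_add_half {z : ℝ} (hz : 1 / 2 < z) :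
    (z - 1 / 2) * Gamma z ^ 2 ≤ Gamma (z + 1 / 2) ^ 2 := by
  have h0 : 0 < z - 1 / 2 := by linarith
  have h1 := sq_Gamma_add_half_le h0
  rw [sub_add_cancel] at h1
  have h2 : Gamma (z + 1 / 2) = (z - 1 / 2) * Gamma (z - 1 / 2) := by
    rw [← Gamma_add_one h0.ne']; ring_nf
  rw [h2]
  nlinarith

/-- The sharp lower bound `(Γ(z + 1/2) / Γ(z))² ≥ z - 1/4`: the quotient of the two sides
decreases under `z ↦ z + 1` and tends to `1`. -/
theorem mul_sq_Gamma_le_sq_Gamma_add_half' {z : ℝ} (hz : 1 / 4 < z) :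
    (z - 1 / 4) * Gamma z ^ 2 ≤ Gamma (z + 1 / 2) ^ 2 := by
  set g : ℝ → ℝ := fun x => Gamma (x + 1 / 2) ^ 2 / ((x - 1 / 4) * Gamma x ^ 2) with hg
  have hstep : ∀ x : ℝ, 1 / 4 < x → g (x + 1) ≤ g x := by
    intro x hx
    have h0 : 0 < x := by linarith
    have h1 := Gamma_pos_of_pos h0
    have h2 := Gamma_pos_of_pos (by linarith : 0 < x + 1 / 2)
    have h4 : 0 < x - 1 / 4 := by linarith
    have h5 : 0 < x + 1 - 1 / 4 := by linarith
    simp only [hg]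
    rw [show x + 1 + 1 / 2 = x + 1 / 2 + 1 by ring, Gamma_add_one h0.ne',
      Gamma_add_one (by linarith : x + 1 / 2 ≠ 0), div_le_div_iff₀ (by positivity) (by positivity)]
    have h3 : (x + 1 / 2) ^ 2 * (x - 1 / 4) ≤ (x + 1 - 1 / 4) * x ^ 2 := by nlinarith
    calc ((x + 1 / 2) * Gamma (x + 1 / 2)) ^ 2 * ((x - 1 / 4) * Gamma x ^ 2)
        = ((x + 1 / 2) ^ 2 * (x - 1 / 4)) * (Gamma (x + 1 / 2) ^ 2 * Gamma x ^ 2) := by ring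
      _ ≤ ((x + 1 - 1 / 4) * x ^ 2) * (Gamma (x + 1 / 2) ^ 2 * Gamma x ^ 2) := by gcongr
      _ = _ := by ring
  have hiter : ∀ m : ℕ, g (z + m) ≤ g z := by
    intro m
    induction m with
    | zero => simp
    | succ m ih =>
      refine le_trans ?_ ih
      have := hstep (z + m) (by linarith [m.cast_nonneg (α := ℝ)])
      rw [add_assoc] at this
      push_cast
      exact this
  -- The lower bound with `z - 1/2`, applied at `z + m`, is asymptotically sharp.
  have hlow : ∀ m : ℕ, 1 ≤ m → 1 - (1 / 4) / (m : ℝ) ≤ g z := by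
    intro m hm
    have hm' : (1 : ℝ) ≤ m := by exact_mod_cast hm
    refine le_trans ?_ (hiter m)
    have h1 := mul_sq_Gamma_le_sq_Gamma_add_half (by linarith : 1 / 2 < z + m)
    have h2 := Gamma_pos_of_pos (by linarith : 0 < z + m)
    have h3 : 0 < z + m - 1 / 4 := by linarith
    simp only [hg]
    rw [le_div_iff₀ (by positivity)]
    refine le_trans ?_ h1
    rw [← mul_assoc]
    gcongr
    have h4 : 1 / 4 ≤ 1 / 4 / (m : ℝ) * (z + m - 1 / 4) := by
      rw [div_mul_eq_mul_div, le_div_iff₀ (by linarith)]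
      nlinarith
    nlinarith
  have hlim : Tendsto (fun m : ℕ => 1 - (1 / 4) / (m : ℝ)) atTop (𝓝 (1 - 0)) :=
    tendsto_const_nhds.sub (tendsto_const_div_atTop_nhds_zero_nat _)
  have h1 : 1 - 0 ≤ g z := le_of_tendsto hlim (eventually_atTop.2 ⟨1, hlow⟩)
  have h2 := Gamma_pos_of_pos (by linarith : 0 < z)
  have h4 : 0 < z - 1 / 4 := by linarith
  rw [sub_zero, hg, le_div_iff₀ (by positivity)] at h1
  linarith

/-- A consequence of the log-convexity of `Γ` between `x - 1` and `x + δ`. -/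
theorem Gamma_mul_rpow_le_Gamma_add {x δ : ℝ} (hx : 1 < x) (hδ : 0 < δ) :
    Gamma x * (x - 1) ^ δ ≤ Gamma (x + δ) := by
  have h0 : 0 < x - 1 := by linarith
  have h1 := Gamma_pos_of_pos h0
  have h2 := Gamma_pos_of_pos (by linarith : 0 < x + δ)
  have h3 := Gamma_pos_of_pos (by linarith : 0 < x)
  have h := Gamma_mul_add_mul_le_rpow_Gamma_mul_rpow_Gamma h0 (by linarith : 0 < x + δ)
    (by positivity : 0 < δ / (1 + δ)) (by positivity : 0 < 1 / (1 + δ)) (by field_simp; ring)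
  rw [show δ / (1 + δ) * (x - 1) + 1 / (1 + δ) * (x + δ) = x by field_simp; ring] at h
  have h4 := rpow_le_rpow h3.le h (by positivity : 0 ≤ 1 + δ)
  rw [mul_rpow (by positivity) (by positivity), ← rpow_mul h1.le, ← rpow_mul h2.le,
    div_mul_cancel₀ _ (by positivity), div_mul_cancel₀ _ (by positivity), rpow_one,
    rpow_add h3, rpow_one] at h4
  have h5 : Gamma x = (x - 1) * Gamma (x - 1) := by
    rw [← Gamma_add_one h0.ne']; ring_nf
  have h6 : Gamma x ^ δ = (x - 1) ^ δ * Gamma (x - 1) ^ δ := by rw [h5, mul_rpow h0.le h1.le]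
  rw [h6] at h4
  have h7 : 0 < Gamma (x - 1) ^ δ := by positivity
  refine le_of_mul_le_mul_right ?_ h7
  linarith

/-- `Γ(x + η) / Γ(x)` is nondecreasing in `x`, by the log-convexity of `Γ`. -/
theorem Gamma_add_mul_Gamma_add_le {x δ η : ℝ} (hx : 0 < x) (hδ : 0 < δ) (hη : 0 < η) :
    Gamma (x + η) * Gamma (x + δ) ≤ Gamma x * Gamma (x + δ + η) := by
  have hs : 0 < δ + η := by linarith
  have h1 := Gamma_pos_of_pos hx
  have h2 := Gamma_pos_of_pos (by linarith : 0 < x + δ + η)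
  have h3 := Gamma_mul_add_mul_le_rpow_Gamma_mul_rpow_Gamma hx (by linarith : 0 < x + δ + η)
    (by positivity : 0 < δ / (δ + η)) (by positivity : 0 < η / (δ + η)) (by field_simp)
  have h4 := Gamma_mul_add_mul_le_rpow_Gamma_mul_rpow_Gamma hx (by linarith : 0 < x + δ + η)
    (by positivity : 0 < η / (δ + η)) (by positivity : 0 < δ / (δ + η)) (by field_simp; ring)
  rw [show δ / (δ + η) * x + η / (δ + η) * (x + δ + η) = x + η by field_simp; ring] at h3
  rw [show η / (δ + η) * x + δ / (δ + η) * (x + δ + η) = x + δ by field_simp; ring] at h4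
  refine (mul_le_mul h3 h4 (Gamma_pos_of_pos (by linarith)).le (by positivity)).trans_eq ?_
  rw [mul_mul_mul_comm, ← rpow_add h1, ← rpow_add h2,
    show δ / (δ + η) + η / (δ + η) = 1 by field_simp,
    show η / (δ + η) + δ / (δ + η) = 1 by field_simp; ring, rpow_one, rpow_one]

end GammaInequalities

/-! ### Uniform bounds for Legendre polynomials and their fractional integrals -/

section SoninBounds

open Polynomial

/-- The Legendre polynomial in the variable `t = 1 - x`. -/
noncomputable def legendreT (n : ℕ) : ℝ[X] := (legendreP n).comp (1 - X)

theorem eval_legendreT (n : ℕ) (t : ℝ) : (legendreT n).eval t = (legendreP n).eval (1 - t) := by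
  simp [legendreT]

theorem derivative_legendreT (n : ℕ) :
    derivative (legendreT n) = -(derivative (legendreP n)).comp (1 - X) := by
  simp [legendreT, derivative_comp]

theorem legendreT_ode (n : ℕ) :
    (2 * X - X ^ 2) * derivative (derivative (legendreT n)) +
      2 * (1 - X) * derivative (legendreT n) + C ((n : ℝ) * (n + 1)) * legendreT n = 0 := by
  have h := congrArg (fun p => p.comp (1 - X)) (legendreP_ode n)
  have h2 : derivative (derivative (legendreT n)) =
      (derivative (derivative (legendreP n))).comp (1 - X) := by
    simp [derivative_legendreT, derivative_comp]
  simp only [add_comp, sub_comp, mul_comp, pow_comp, X_comp, one_comp, C_comp, zero_comp,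
    ofNat_comp] at h
  rw [h2, derivative_legendreT, legendreT]
  push_cast at h
  linear_combination h

/-- The derivative of Sonin's function of a solution of the Gegenbauer equation
`(2t - t²) w'' - 2 (s - 1) (1 - t) w' + l w = 0`. For `l > 0` it has the sign of
`(2s - 1) (1 - t)`. -/
theorem hasDerivAt_sonin {w w₁ : ℝ → ℝ} {s l t w₂ : ℝ} (hl : l ≠ 0) (h1 : HasDerivAt w (w₁ t) t)
    (h2 : HasDerivAt w₁ w₂ t)
    (h3 : (2 * t - t ^ 2) * w₂ - 2 * (s - 1) * (1 - t) * w₁ t + l * w t = 0) :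
    HasDerivAt (fun t => w t ^ 2 + (2 * t - t ^ 2) / l * w₁ t ^ 2)
      ((2 * s - 1) * (2 * (1 - t) / l * w₁ t ^ 2)) t := by
  have h4 : HasDerivAt (fun t : ℝ => (2 * t - t ^ 2) / l) ((2 - 2 * t) / l) t := by
    have := (((hasDerivAt_id t).const_mul 2).sub ((hasDerivAt_id t).pow 2)).div_const l
    simpa using this
  refine ((h1.pow 2).add (h4.mul (h2.pow 2))).congr_deriv ?_
  field_simp
  simp only [Nat.cast_ofNat, Nat.add_one_sub_one, pow_one, Pi.pow_apply]
  linear_combination 2 * w₁ t * h3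

theorem monotoneOn_of_hasDerivAt_Ioo {F F' : ℝ → ℝ} {a b : ℝ} (hc : ContinuousOn F (Icc a b))
    (hd : ∀ t ∈ Ioo a b, HasDerivAt F (F' t) t) (h0 : ∀ t ∈ Ioo a b, 0 ≤ F' t) :
    MonotoneOn F (Icc a b) := by
  refine monotoneOn_of_deriv_nonneg (convex_Icc a b) hc ?_ ?_ <;> rw [interior_Icc]
  · exact fun t ht => (hd t ht).differentiableAt.differentiableWithinAt
  · exact fun t ht => by rw [(hd t ht).deriv]; exact h0 t ht

theorem antitoneOn_of_hasDerivAt_Ioo {F F' : ℝ → ℝ} {a b : ℝ} (hc : ContinuousOn F (Icc a b))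
    (hd : ∀ t ∈ Ioo a b, HasDerivAt F (F' t) t) (h0 : ∀ t ∈ Ioo a b, F' t ≤ 0) :
    AntitoneOn F (Icc a b) := by
  refine antitoneOn_of_deriv_nonpos (convex_Icc a b) hc ?_ ?_ <;> rw [interior_Icc]
  · exact fun t ht => (hd t ht).differentiableAt.differentiableWithinAt
  · exact fun t ht => by rw [(hd t ht).deriv]; exact h0 t ht

/-- For `s = 0` Sonin's function is largest at the endpoints of `[-1, 1]`, where it equals `1`. -/
theorem abs_eval_legendreP_le_one (n : ℕ) {x : ℝ} (hx : x ∈ Icc (-1 : ℝ) 1) :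
    |(legendreP n).eval x| ≤ 1 := by
  rcases Nat.eq_zero_or_pos n with rfl | hn
  · simp [legendreP_zero]
  have hl : (0 : ℝ) < n * (n + 1) := by positivity
  set F : ℝ → ℝ := fun t => (legendreT n).eval t ^ 2 +
    (2 * t - t ^ 2) / (n * (n + 1)) * (derivative (legendreT n)).eval t ^ 2 with hF
  have hd : ∀ t, HasDerivAt F ((2 * 0 - 1) * (2 * (1 - t) / (n * (n + 1)) *
      (derivative (legendreT n)).eval t ^ 2)) t := by
    intro t
    refine hasDerivAt_sonin hl.ne' (Polynomial.hasDerivAt _ t) (Polynomial.hasDerivAt _ t) ?_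
    have h := congrArg (eval t) (legendreT_ode n)
    simp at h
    linear_combination h
  have hc : Continuous F := continuous_iff_continuousAt.2 fun t => (hd t).continuousAt
  have h1 : AntitoneOn F (Icc 0 1) := by
    refine antitoneOn_of_hasDerivAt_Ioo hc.continuousOn (fun t _ => hd t) fun t ht => ?_
    have : 0 ≤ 2 * (1 - t) / (n * (n + 1)) * (derivative (legendreT n)).eval t ^ 2 := by
      have : 0 ≤ 1 - t := by linarith [ht.2]
      positivity
    linarith
  have h2 : MonotoneOn F (Icc 1 2) := by
    refine monotoneOn_of_hasDerivAt_Ioo hc.continuousOn (fun t _ => hd t) fun t ht => ?_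
    have : 0 ≤ 2 * (t - 1) / (n * (n + 1)) * (derivative (legendreT n)).eval t ^ 2 := by
      have : 0 ≤ t - 1 := by linarith [ht.1]
      positivity
    refine this.trans_eq ?_
    ring
  have hF0 : F 0 = 1 := by simp [hF, eval_legendreT, eval_one_legendreP]
  have hF2 : F 2 = 1 := by
    have := eval_neg_legendreP n 1
    rw [eval_one_legendreP] at this
    simp only [hF, eval_legendreT]
    norm_num [this, ← pow_mul, mul_comm n 2]
  have hle : ∀ t ∈ Icc (0 : ℝ) 2, F t ≤ 1 := by
    intro t ht
    rcases le_total t 1 with h | h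
    · exact hF0 ▸ h1 (by norm_num) ⟨ht.1, h⟩ ht.1
    · exact hF2 ▸ h2 ⟨h, ht.2⟩ (by norm_num) ht.2
  have h3 := hle (1 - x) ⟨by linarith [hx.2], by linarith [hx.1]⟩
  have h4 : 0 ≤ (2 * (1 - x) - (1 - x) ^ 2) / (n * (n + 1)) *
      (derivative (legendreT n)).eval (1 - x) ^ 2 := by
    have : 0 ≤ 2 * (1 - x) - (1 - x) ^ 2 := by nlinarith [hx.1, hx.2]
    positivity
  simp only [hF, eval_legendreT, sub_sub_cancel] at h3
  exact abs_le_one_iff_mul_self_le_one.2 (by nlinarith)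

/-- For `s > 1/2` Sonin's function is largest at the midpoint `t = 1`. The restriction to `s ≥ 1`
makes it continuous at `t = 0`. -/
theorem sq_fracPoly_legendreT_le_aux {n : ℕ} {s : ℝ} (hs : 1 ≤ s) (hsn : s < n + 1) {t : ℝ}
    (ht : t ∈ Icc (0 : ℝ) 2) :
    fracPoly s (legendreT n) t ^ 2 ≤ fracPoly s (legendreT n) 1 ^ 2 +
      fracPoly (s - 1) (legendreT n) 1 ^ 2 / ((n + s) * (n + 1 - s)) := by
  have hl : 0 < (n + s) * (n + 1 - s) := mul_pos (by positivity) (by linarith)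
  set F : ℝ → ℝ := fun t => fracPoly s (legendreT n) t ^ 2 +
    (2 * t - t ^ 2) / ((n + s) * (n + 1 - s)) * fracPoly (s - 1) (legendreT n) t ^ 2 with hF
  have hd : ∀ t, 0 < t → HasDerivAt F ((2 * s - 1) * (2 * (1 - t) / ((n + s) * (n + 1 - s)) *
      fracPoly (s - 1) (legendreT n) t ^ 2)) t := by
    intro t ht
    refine hasDerivAt_sonin hl.ne' (hasDerivAt_fracPoly _ _ ht) (hasDerivAt_fracPoly _ _ ht) ?_
    have h := fracPoly_legendre_operator s (n * (n + 1)) (legendreT n) ht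
    rw [legendreT_ode, fracPoly_zero] at h
    linear_combination h
  have hc : Continuous F := by
    have h1 := continuous_fracPoly (by linarith : 0 ≤ s) (legendreT n)
    have h2 := continuous_fracPoly (by linarith : 0 ≤ s - 1) (legendreT n)
    fun_prop
  have h1 : MonotoneOn F (Icc 0 1) := by
    refine monotoneOn_of_hasDerivAt_Ioo hc.continuousOn (fun t ht => hd t ht.1) fun t ht => ?_
    have : 0 ≤ 1 - t := by linarith [ht.2]
    have : 0 ≤ 2 * s - 1 := by linarith
    positivity
  have h2 : AntitoneOn F (Icc 1 2) := by
    refine antitoneOn_of_hasDerivAt_Ioo hc.continuousOn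
      (fun t ht => hd t (by linarith [ht.1])) fun t ht => ?_
    have : 0 ≤ (2 * s - 1) * (2 * (t - 1) / ((n + s) * (n + 1 - s)) *
        fracPoly (s - 1) (legendreT n) t ^ 2) := by
      have : 0 ≤ t - 1 := by linarith [ht.1]
      have : 0 ≤ 2 * s - 1 := by linarith
      positivity
    rw [← neg_nonneg]
    refine this.trans_eq ?_
    ring
  have hle : F t ≤ F 1 := by
    rcases le_total t 1 with h | h
    · exact h1 ⟨ht.1, h⟩ (by norm_num) h
    · exact h2 (by norm_num) ⟨h, ht.2⟩ h
  have h4 : 0 ≤ (2 * t - t ^ 2) / ((n + s) * (n + 1 - s)) *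
      fracPoly (s - 1) (legendreT n) t ^ 2 := by
    have : 0 ≤ 2 * t - t ^ 2 := by nlinarith [ht.1, ht.2]
    positivity
  have h5 : F 1 = fracPoly s (legendreT n) 1 ^ 2 +
      fracPoly (s - 1) (legendreT n) 1 ^ 2 / ((n + s) * (n + 1 - s)) := by
    simp only [hF]; ring
  rw [← h5]
  refine le_trans ?_ hle
  simp only [hF]
  linarith

/-- The three-term relation for `x (P_{n+2} - P_n)'`, integrated fractionally, becomes a two-term
recurrence for the values at the midpoint. -/
theorem fracPoly_legendreT_add_two (n : ℕ) (s : ℝ) :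
    (n + 2 + s) * fracPoly s (legendreT (n + 2)) 1 = (s - n - 1) * fracPoly s (legendreT n) 1 := by
  have h1 : (1 - X) * derivative (legendreT (n + 2) - legendreT n) =
      C (-1) * (C ((n : ℝ) + 2) * legendreT (n + 2) + C ((n : ℝ) + 1) * legendreT n) := by
    have h := congrArg (fun p => p.comp (1 - X)) (X_mul_derivative_legendreP_sub n)
    simp only [add_comp, sub_comp, mul_comp, X_comp, C_comp, derivative_sub] at h
    rw [derivative_sub, derivative_legendreT, derivative_legendreT, legendreT, legendreT]
    simp only [map_neg, map_one]
    linear_combination -h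
  have h2 := fracPoly_one_euler s (legendreT (n + 2) - legendreT n)
    (by simp [eval_legendreT, eval_one_legendreP])
  rw [h1, fracPoly_sub, fracPoly_C_mul, fracPoly_add, fracPoly_C_mul, fracPoly_C_mul] at h2
  linarith

/-- The value at the midpoint of `[-1, 1]` of the fractional integral of order `s` of `P_n`. -/
theorem fracPoly_legendreT_one (n : ℕ) {s : ℝ} (hs : 0 ≤ s) :
    fracPoly s (legendreT n) 1 = √Real.pi * 2 ^ (-s) * (Real.Gamma ((1 + s - n) / 2))⁻¹ *
      (Real.Gamma ((s + n + 2) / 2))⁻¹ := by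
  have hpi : 0 < √Real.pi := Real.sqrt_pos.2 Real.pi_pos
  induction n using Nat.twoStepInduction with
  | zero =>
    have h1 : legendreT 0 = monomial 0 1 := by simp [legendreT, legendreP_zero]
    have h2 := Real.Gamma_mul_Gamma_add_half ((1 + s) / 2)
    rw [show (1 + s) / 2 + 1 / 2 = (s + 2) / 2 by ring, show 2 * ((1 + s) / 2) = 1 + s by ring,
      show 1 - (1 + s) = -s by ring] at h2
    have h3 := Real.Gamma_pos_of_pos (by linarith : 0 < 1 + s)
    have h4 : (0 : ℝ) < 2 ^ (-s) := by positivity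
    rw [h1, fracPoly_monomial]
    simp only [Nat.cast_zero, zero_add, sub_zero, add_zero, Real.one_rpow, Nat.factorial_zero,
      Nat.cast_one, one_mul, mul_one]
    rw [mul_assoc, ← mul_inv, h2]
    field_simp
  | one =>
    have h1 : legendreT 1 = monomial 0 1 - monomial 1 1 := by
      simp [legendreT, legendreP_one, monomial_one_one_eq_X]
    have h2 := Real.Gamma_mul_Gamma_add_half (s / 2 + 1)
    rw [show s / 2 + 1 + 1 / 2 = (s + 1 + 2) / 2 by ring, show 2 * (s / 2 + 1) = 1 + s + 1 by ring,
      show 1 - (1 + s + 1) = -s - 1 by ring, Real.rpow_sub_one two_ne_zero] at h2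
    have h3 := Real.Gamma_pos_of_pos (by linarith : 0 < 1 + s + 1)
    have h4 : (0 : ℝ) < 2 ^ (-s) := by positivity
    rw [h1, fracPoly_sub, fracPoly_monomial, fracPoly_monomial]
    simp only [Nat.cast_zero, zero_add, Real.one_rpow, Nat.factorial_zero, Nat.factorial_one,
      Nat.cast_one, one_mul, mul_one]
    rw [inv_Gamma_eq_self_mul_inv_Gamma_add_one (1 + s), show (1 + s - 1) / 2 = s / 2 by ring,
      inv_Gamma_eq_self_mul_inv_Gamma_add_one (s / 2), mul_assoc, mul_assoc (s / 2),
      ← mul_inv, h2,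
      show (1 : ℝ) + 1 + s = 1 + s + 1 by ring]
    field_simp
    ring
  | more n ih _ =>
    have h1 := fracPoly_legendreT_add_two n s
    have h2 := inv_Gamma_eq_self_mul_inv_Gamma_add_one ((1 + s - (n + 2 : ℕ)) / 2)
    rw [show (1 + s - ((n + 2 : ℕ) : ℝ)) / 2 + 1 = (1 + s - n) / 2 by push_cast; ring] at h2
    have h3 : Real.Gamma ((s + (n + 2 : ℕ) + 2) / 2) =
        (s + n + 2) / 2 * Real.Gamma ((s + n + 2) / 2) := by
      rw [← Real.Gamma_add_one (by positivity)]
      congr 1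
      push_cast
      ring
    have h4 : 0 < (n : ℝ) + 2 + s := by positivity
    have h5 : 0 < s + n + 2 := by positivity
    rw [h2, h3]
    rw [ih] at h1
    refine mul_left_cancel₀ h4.ne' (h1.trans ?_)
    have := Real.Gamma_pos_of_pos (by positivity : 0 < (s + n + 2) / 2)
    push_cast
    field_simp
    ring

theorem inv_Gamma_one_sub {y : ℝ} (hy : 0 < y) :
    (Real.Gamma (1 - y))⁻¹ = Real.Gamma y * Real.sin (Real.pi * y) / Real.pi := by
  have h := Real.Gamma_mul_Gamma_one_sub y
  have h1 := (Real.Gamma_pos_of_pos hy).ne'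
  have h2 : Real.Gamma (1 - y) = Real.pi / Real.sin (Real.pi * y) / Real.Gamma y := by
    rw [← h]; field_simp
  rw [h2, div_div, inv_div]
  ring

/-- The midpoint value with the factor `1 / Γ((1 + s - n) / 2)` rewritten by the reflection
formula. -/
theorem fracPoly_legendreT_one' (n : ℕ) {s : ℝ} (hs : 0 ≤ s) (hsn : s < n + 1) :
    fracPoly s (legendreT n) 1 = 2 ^ (-s) / √Real.pi * Real.Gamma ((n + 1 - s) / 2) /
      Real.Gamma ((n + s + 2) / 2) * Real.sin (Real.pi * ((n + 1 - s) / 2)) := by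
  have h1 := inv_Gamma_one_sub (by linarith : 0 < (n + 1 - s) / 2)
  have h2 : √Real.pi * √Real.pi = Real.pi := Real.mul_self_sqrt Real.pi_pos.le
  have h3 : 0 < √Real.pi := Real.sqrt_pos.2 Real.pi_pos
  rw [show 1 - ((n : ℝ) + 1 - s) / 2 = (1 + s - n) / 2 by ring] at h1
  rw [fracPoly_legendreT_one n hs, h1, show s + n + 2 = n + s + 2 by ring]
  have h4 := Real.Gamma_pos_of_pos (by positivity : 0 < (n + s + 2) / 2)
  field_simp
  rw [show √Real.pi ^ 2 = Real.pi by rw [sq, h2]]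
  ring

/-- The factor common to Sonin's function at the midpoint and its bound: the fractional integral of
order `s` of `P_n` is at most `√(2 / (n + s))` times this number. -/
noncomputable def legendreAmp (n : ℕ) (s : ℝ) : ℝ :=
  2 ^ (-s) / √Real.pi * Real.Gamma ((n + 1 - s) / 2) / Real.Gamma ((n + s + 1) / 2)

theorem legendreAmp_pos {n : ℕ} {s : ℝ} (hs : 0 ≤ s) (hsn : s < n + 1) : 0 < legendreAmp n s := by
  have h3 : 0 < √Real.pi := Real.sqrt_pos.2 Real.pi_pos
  have h4 := Real.Gamma_pos_of_pos (by positivity : 0 < (n + s + 1) / 2)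
  have h5 := Real.Gamma_pos_of_pos (by linarith : 0 < (n + 1 - s) / 2)
  unfold legendreAmp
  positivity

/-- Uniform bound for the fractional integrals of a Legendre polynomial: Sonin's function is
largest at the midpoint, where its two terms carry `sin²` and `cos²` of the same angle. -/
theorem sq_fracPoly_legendreT_le {n : ℕ} {s : ℝ} (hs : 1 ≤ s) (hsn : s < n + 1) {t : ℝ}
    (ht : t ∈ Icc (0 : ℝ) 2) :
    fracPoly s (legendreT n) t ^ 2 ≤ 2 / (n + s) * legendreAmp n s ^ 2 := by
  refine (sq_fracPoly_legendreT_le_aux hs hsn ht).trans ?_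
  set y : ℝ := (n + 1 - s) / 2 with hy
  set z : ℝ := (n + s + 1) / 2 with hz
  set a : ℝ := 2 ^ (-s) / √Real.pi with ha
  have hn : (0 : ℝ) ≤ n := n.cast_nonneg
  have hy0 : 0 < y := by rw [hy]; linarith
  have hz0 : 1 / 2 < z := by rw [hz]; linarith
  have hpi : 0 < √Real.pi := Real.sqrt_pos.2 Real.pi_pos
  have ha0 : 0 < a := by positivity
  have hK : legendreAmp n s = a * Real.Gamma y / Real.Gamma z := rfl
  have h1 : fracPoly s (legendreT n) 1 =
      a * Real.Gamma y / Real.Gamma (z + 1 / 2) * Real.sin (Real.pi * y) := by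
    rw [fracPoly_legendreT_one' n (by linarith) hsn, ← hy, ← ha,
      show (n + s + 2) / 2 = z + 1 / 2 by rw [hz]; ring]
  have h2 : fracPoly (s - 1) (legendreT n) 1 =
      2 * a * Real.Gamma (y + 1 / 2) / Real.Gamma z * Real.cos (Real.pi * y) := by
    rw [fracPoly_legendreT_one' n (by linarith) (by linarith),
      show (n + 1 - (s - 1)) / 2 = y + 1 / 2 by rw [hy]; ring,
      show (n + (s - 1) + 2) / 2 = z by rw [hz]; ring, mul_add,
      show Real.pi * (1 / 2) = Real.pi / 2 by ring, Real.sin_add_pi_div_two,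
      show -(s - 1) = -s + 1 by ring, Real.rpow_add_one two_ne_zero, ha]
    ring
  have hgy := Real.Gamma_pos_of_pos hy0
  have hgz := Real.Gamma_pos_of_pos (by linarith : 0 < z)
  have hgz' := Real.Gamma_pos_of_pos (by linarith : 0 < z + 1 / 2)
  have h3 := mul_sq_Gamma_le_sq_Gamma_add_half hz0
  have h4 := sq_Gamma_add_half_le hy0
  rw [h1, h2, hK, show (n : ℝ) + s = 2 * (z - 1 / 2) by rw [hz]; ring,
    show (n : ℝ) + 1 - s = 2 * y by rw [hy]; ring]
  have hz1 : 0 < z - 1 / 2 := by linarith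
  have h5 : (a * Real.Gamma y / Real.Gamma (z + 1 / 2) * Real.sin (Real.pi * y)) ^ 2 ≤
      a ^ 2 * Real.Gamma y ^ 2 / (Real.Gamma z ^ 2 * (z - 1 / 2)) * Real.sin (Real.pi * y) ^ 2 := by
    rw [mul_pow]
    gcongr
    rw [div_pow, mul_pow]
    gcongr
    linarith
  have h6 : (2 * a * Real.Gamma (y + 1 / 2) / Real.Gamma z * Real.cos (Real.pi * y)) ^ 2 /
        (2 * (z - 1 / 2) * (2 * y)) ≤
      a ^ 2 * Real.Gamma y ^ 2 / (Real.Gamma z ^ 2 * (z - 1 / 2)) * Real.cos (Real.pi * y) ^ 2 := by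
    rw [div_le_iff₀ (by positivity)]
    calc (2 * a * Real.Gamma (y + 1 / 2) / Real.Gamma z * Real.cos (Real.pi * y)) ^ 2
        = 4 * a ^ 2 / Real.Gamma z ^ 2 * Real.cos (Real.pi * y) ^ 2 *
            Real.Gamma (y + 1 / 2) ^ 2 := by ring
      _ ≤ 4 * a ^ 2 / Real.Gamma z ^ 2 * Real.cos (Real.pi * y) ^ 2 * (y * Real.Gamma y ^ 2) := by
          gcongr
      _ = _ := by
          obtain ⟨d, hd⟩ : ∃ d, d = z - 1 / 2 := ⟨_, rfl⟩
          rw [← hd] at hz1 ⊢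
          field_simp
          ring
  refine (add_le_add h5 h6).trans_eq ?_
  rw [← mul_add, Real.sin_sq_add_cos_sq, mul_one]
  field_simp

end SoninBounds

/-! ### A Bernstein inequality for Legendre polynomials -/

section Bernstein

open Polynomial

/-- Sonin's function of `(1 - x²)^{1/4} P_n(x)` in the variable `arccos x`, written in terms
of `x`. -/
noncomputable def bernsteinSonin (n : ℕ) (x : ℝ) : ℝ :=
  √(1 - x ^ 2) * ((legendreP n).eval x ^ 2 +
    (x * (legendreP n).eval x / 2 - (1 - x ^ 2) * (derivative (legendreP n)).eval x) ^ 2 /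
      (((n : ℝ) + 1 / 2) ^ 2 * (1 - x ^ 2) + 1 / 4))

theorem hasDerivAt_bernsteinSonin (n : ℕ) {x : ℝ} (hx : x ∈ Ioo (-1 : ℝ) 1) :
    HasDerivAt (bernsteinSonin n) (-x *
      ((x * (legendreP n).eval x / 2 - (1 - x ^ 2) * (derivative (legendreP n)).eval x) ^ 2 /
      (2 * (((n : ℝ) + 1 / 2) ^ 2 * (1 - x ^ 2) + 1 / 4) ^ 2 * √(1 - x ^ 2)))) x := by
  have hc : 0 < 1 - x ^ 2 := by nlinarith [hx.1, hx.2]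
  have hr : 0 < √(1 - x ^ 2) := Real.sqrt_pos.2 hc
  have hr2 : √(1 - x ^ 2) ^ 2 = 1 - x ^ 2 := Real.sq_sqrt hc.le
  set P := (legendreP n).eval x with hP
  set P' := (derivative (legendreP n)).eval x with hP'
  set P'' := (derivative (derivative (legendreP n))).eval x with hP''
  have hode : (1 - x ^ 2) * P'' = 2 * x * P' - n * (n + 1) * P := by
    have h := congrArg (eval x) (legendreP_ode n)
    simp at h
    linear_combination h
  have h1 : HasDerivAt (fun x : ℝ => 1 - x ^ 2) (-(2 * x)) x := by
    simpa using ((hasDerivAt_id x).pow 2).const_sub 1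
  have h2 := h1.sqrt hc.ne'
  have h3 : HasDerivAt (fun x => (legendreP n).eval x) P' x := Polynomial.hasDerivAt _ x
  have h4 : HasDerivAt (fun x => (derivative (legendreP n)).eval x) P'' x :=
    Polynomial.hasDerivAt _ x
  have h5 : HasDerivAt (fun x => x * (legendreP n).eval x / 2 -
      (1 - x ^ 2) * (derivative (legendreP n)).eval x)
      (x * P' / 2 + (((n : ℝ) + 1 / 2) ^ 2 + 1 / 4) * P) x := by
    refine ((((hasDerivAt_id x).mul h3).div_const 2).sub (h1.mul h4)).congr_deriv ?_
    simp only [id, ← hP, ← hP']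
    linear_combination -hode
  have h6 : HasDerivAt (fun x : ℝ => ((n : ℝ) + 1 / 2) ^ 2 * (1 - x ^ 2) + 1 / 4)
      (((n : ℝ) + 1 / 2) ^ 2 * (-(2 * x))) x := (h1.const_mul _).add_const _
  have hD : 0 < ((n : ℝ) + 1 / 2) ^ 2 * (1 - x ^ 2) + 1 / 4 := by positivity
  refine (h2.mul ((h3.pow 2).add ((h5.pow 2).div h6 hD.ne'))).congr_deriv ?_
  simp only [Pi.pow_apply, Pi.add_apply, Pi.div_apply, Nat.cast_ofNat, Nat.add_one_sub_one,
    pow_one, ← hP, ← hP']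
  set r := √(1 - x ^ 2)
  set D := ((n : ℝ) + 1 / 2) ^ 2 * (1 - x ^ 2) + 1 / 4 with hDdef
  set B := x * P / 2 - (1 - x ^ 2) * P' with hB
  -- With `B' = x P' / 2 + ((n + 1/2)² + 1/4) P` one has `r² B' = P D - x B / 2`.
  have e1 : r ^ 2 * (x * P' / 2 + (((n : ℝ) + 1 / 2) ^ 2 + 1 / 4) * P) = P * D - x * B / 2 := by
    rw [hr2, hDdef, hB]; ring
  have e2 : r ^ 2 * P' = x * P / 2 - B := by rw [hr2, hB]; ring
  have e3 : r ^ 2 * ((n : ℝ) + 1 / 2) ^ 2 = D - 1 / 4 := by rw [hr2, hDdef]; ring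
  generalize x * P' / 2 + (((n : ℝ) + 1 / 2) ^ 2 + 1 / 4) * P = B' at e1 ⊢
  generalize ((n : ℝ) + 1 / 2) ^ 2 = M at e3 ⊢
  have hD0 : D ≠ 0 := hD.ne'
  clear_value B D r
  field_simp
  linear_combination 4 * B * D * e1 + 4 * P * D ^ 2 * e2 + 4 * x * B ^ 2 * e3

/-- The derivative of Sonin's function has the sign of `-x`. -/
theorem bernsteinSonin_le (n : ℕ) {x : ℝ} (hx : x ∈ Ioo (-1 : ℝ) 1) :
    bernsteinSonin n x ≤ bernsteinSonin n 0 := by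
  have hd := fun {y : ℝ} (hy : y ∈ Ioo (-1 : ℝ) 1) => hasDerivAt_bernsteinSonin n hy
  have hpos : ∀ y : ℝ, 0 ≤
      ((y * (legendreP n).eval y / 2 - (1 - y ^ 2) * (derivative (legendreP n)).eval y) ^ 2 /
      (2 * (((n : ℝ) + 1 / 2) ^ 2 * (1 - y ^ 2) + 1 / 4) ^ 2 * √(1 - y ^ 2))) := by
    intro y; positivity
  rcases le_total 0 x with h | h
  · have hsub : ∀ y ∈ Icc 0 x, y ∈ Ioo (-1 : ℝ) 1 := fun y hy =>
      ⟨by linarith [hy.1], by linarith [hy.2, hx.2]⟩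
    refine antitoneOn_of_hasDerivAt_Ioo (a := 0) (b := x)
      (fun y hy => (hd (hsub y hy)).continuousAt.continuousWithinAt)
      (fun y hy => hd (hsub y (Ioo_subset_Icc_self hy))) (fun y hy => ?_) ⟨le_rfl, h⟩ ⟨h, le_rfl⟩ h
    exact mul_nonpos_of_nonpos_of_nonneg (by linarith [hy.1]) (hpos y)
  · have hsub : ∀ y ∈ Icc x 0, y ∈ Ioo (-1 : ℝ) 1 := fun y hy =>
      ⟨by linarith [hy.1, hx.1], by linarith [hy.2]⟩
    refine monotoneOn_of_hasDerivAt_Ioo (a := x) (b := 0)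
      (fun y hy => (hd (hsub y hy)).continuousAt.continuousWithinAt)
      (fun y hy => hd (hsub y (Ioo_subset_Icc_self hy))) (fun y hy => ?_) ⟨le_rfl, h⟩ ⟨h, le_rfl⟩ h
    exact mul_nonneg (by linarith [hy.2]) (hpos y)

/-- At `0` the two terms of Sonin's function carry `sin²` and `cos²` of the same angle. -/
theorem bernsteinSonin_zero_le {n : ℕ} (hn : 1 ≤ n) :
    bernsteinSonin n 0 ≤ 2 / Real.pi * ((n + 1) / ((n : ℝ) + 1 / 2) ^ 2) := by
  obtain ⟨m, rfl⟩ : ∃ m, n = m + 1 := ⟨n - 1, by omega⟩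
  set z : ℝ := ((m : ℝ) + 2) / 2 with hz
  have hpi : 0 < √Real.pi := Real.sqrt_pos.2 Real.pi_pos
  have hpi0 := Real.pi_pos
  have hpi2 : √Real.pi ^ 2 = Real.pi := Real.sq_sqrt Real.pi_pos.le
  have hz1 : 1 ≤ z := by rw [hz]; linarith [m.cast_nonneg (α := ℝ)]
  have h1 : (legendreP (m + 1)).eval 0 =
      1 / √Real.pi * Real.Gamma z / Real.Gamma (z + 1 / 2) * Real.sin (Real.pi * z) := by
    have h := fracPoly_legendreT_one' (m + 1) (s := 0) le_rfl (by positivity)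
    rw [fracPoly_order_zero, eval_legendreT, sub_self, neg_zero, Real.rpow_zero] at h
    rw [h, show (((m + 1 : ℕ) : ℝ) + 1 - 0) / 2 = z by rw [hz]; push_cast; ring,
      show (((m + 1 : ℕ) : ℝ) + 0 + 2) / 2 = z + 1 / 2 by rw [hz]; push_cast; ring]
  have h2 : (derivative (legendreP (m + 1))).eval 0 =
      -(2 / √Real.pi * Real.Gamma (z + 1 / 2) / Real.Gamma z * Real.cos (Real.pi * z)) := by
    have h := fracPoly_legendreT_one' m (s := 0) le_rfl (by positivity)
    rw [fracPoly_order_zero, eval_legendreT, sub_self, neg_zero, Real.rpow_zero] at h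
    have h3 : Real.Gamma (z + 1 / 2) = (z - 1 / 2) * Real.Gamma (z - 1 / 2) := by
      rw [← Real.Gamma_add_one (by linarith)]; ring_nf
    rw [eval_zero_derivative_legendreP_succ, h, h3,
      show ((m : ℝ) + 1 - 0) / 2 = z - 1 / 2 by rw [hz]; ring,
      show ((m : ℝ) + 0 + 2) / 2 = z by rw [hz]; ring, mul_sub,
      show Real.pi * (1 / 2) = Real.pi / 2 by ring, Real.sin_sub_pi_div_two,
      show (m : ℝ) + 1 = 2 * (z - 1 / 2) by rw [hz]; ring]
    ring
  have hgz := Real.Gamma_pos_of_pos (by linarith : 0 < z)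
  have hgz' := Real.Gamma_pos_of_pos (by linarith : 0 < z + 1 / 2)
  have h3 := sq_Gamma_add_half_le (by linarith : 0 < z)
  have h4 := mul_sq_Gamma_le_sq_Gamma_add_half' (by linarith : 1 / 4 < z)
  have hz4 : 0 < z - 1 / 4 := by linarith
  have hm : ((m + 1 : ℕ) : ℝ) = 2 * z - 1 := by rw [hz]; push_cast; ring
  have h5 : bernsteinSonin (m + 1) 0 = (legendreP (m + 1)).eval 0 ^ 2 +
      (derivative (legendreP (m + 1))).eval 0 ^ 2 / (4 * (z - 1 / 4) ^ 2 + 1 / 4) := by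
    simp only [bernsteinSonin, hm]
    norm_num
    ring_nf
  have hrhs : 2 / Real.pi * ((((m + 1 : ℕ) : ℝ) + 1) / (((m + 1 : ℕ) : ℝ) + 1 / 2) ^ 2) =
      z / (Real.pi * (z - 1 / 4) ^ 2) := by
    rw [hm, show 2 * z - 1 + 1 / 2 = 2 * (z - 1 / 4) by ring]
    obtain ⟨d, hd⟩ : ∃ d, d = z - 1 / 4 := ⟨_, rfl⟩
    rw [← hd] at hz4 ⊢
    field_simp
    ring
  have h6 : (legendreP (m + 1)).eval 0 ^ 2 ≤
      z / (Real.pi * (z - 1 / 4) ^ 2) * Real.sin (Real.pi * z) ^ 2 := by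
    rw [h1, mul_pow]
    gcongr
    rw [div_pow, mul_pow, div_pow, hpi2, one_pow, div_le_div_iff₀ (by positivity) (by positivity)]
    calc 1 / Real.pi * Real.Gamma z ^ 2 * (Real.pi * (z - 1 / 4) ^ 2)
        = (z - 1 / 4) * ((z - 1 / 4) * Real.Gamma z ^ 2) := by field_simp
      _ ≤ z * Real.Gamma (z + 1 / 2) ^ 2 := by
        apply mul_le_mul _ h4 (by positivity) (by linarith)
        linarith
  have h7 : (derivative (legendreP (m + 1))).eval 0 ^ 2 / (4 * (z - 1 / 4) ^ 2 + 1 / 4) ≤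
      z / (Real.pi * (z - 1 / 4) ^ 2) * Real.cos (Real.pi * z) ^ 2 := by
    have h8 : (2 / √Real.pi * Real.Gamma (z + 1 / 2) / Real.Gamma z) ^ 2 ≤ 4 * z / Real.pi := by
      rw [div_pow, mul_pow, div_pow, hpi2, div_le_div_iff₀ (by positivity) (by positivity)]
      calc 2 ^ 2 / Real.pi * Real.Gamma (z + 1 / 2) ^ 2 * Real.pi
          = 4 * Real.Gamma (z + 1 / 2) ^ 2 := by field_simp; ring
        _ ≤ 4 * (z * Real.Gamma z ^ 2) := by gcongr
        _ = _ := by ring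
    have h9 : (2 / √Real.pi * Real.Gamma (z + 1 / 2) / Real.Gamma z) ^ 2 /
        (4 * (z - 1 / 4) ^ 2 + 1 / 4) ≤ z / (Real.pi * (z - 1 / 4) ^ 2) := by
      obtain ⟨d, hd⟩ : ∃ d, d = z - 1 / 4 := ⟨_, rfl⟩
      rw [← hd] at hz4 ⊢
      calc _ ≤ 4 * z / Real.pi / (4 * d ^ 2) :=
            div_le_div₀ (by positivity) h8 (by positivity) (by linarith)
        _ = _ := by field_simp
    rw [h2, neg_sq, mul_pow, mul_div_right_comm]
    exact mul_le_mul_of_nonneg_right h9 (sq_nonneg _)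
  rw [h5, hrhs]
  refine (add_le_add h6 h7).trans_eq ?_
  rw [← mul_add, Real.sin_sq_add_cos_sq, mul_one]

/-- A form of Bernstein's inequality `(1 - x²)^{1/4} |P_n(x)| ≤ √(2 / (π (n + 1/2)))`. -/
theorem sqrt_mul_sq_legendreP_le {n : ℕ} (hn : 1 ≤ n) {x : ℝ} (hx : x ∈ Ioo (-1 : ℝ) 1) :
    √(1 - x ^ 2) * (legendreP n).eval x ^ 2 ≤
      2 / Real.pi * ((n + 1) / ((n : ℝ) + 1 / 2) ^ 2) := by
  refine le_trans ?_ ((bernsteinSonin_le n hx).trans (bernsteinSonin_zero_le hn))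
  unfold bernsteinSonin
  have hc : 0 < 1 - x ^ 2 := by nlinarith [hx.1, hx.2]
  refine mul_le_mul_of_nonneg_left (le_add_of_nonneg_right ?_) (Real.sqrt_nonneg _)
  positivity

end Bernstein

/-! ### Integrating against a function of bounded variation -/

section BoundedVariationIntegral

/-- The superlevel sets of a monotone function in `(a, b]` are final segments, up to a point. -/
theorem exists_superlevel_ae_eq_Ioc {p : ℝ → ℝ} (hp : Monotone p) {a b : ℝ} (hab : a ≤ b)
    (τ : ℝ) : ∃ c ∈ Icc a b, (Ioc a b ∩ {x | τ < p x} : Set ℝ) =ᵐ[volume] Ioc c b := by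
  set S : Set ℝ := (Ioc a b ∩ {x | τ < p x}) ∪ {b} with hS
  have hSb : b ∈ S := Or.inr rfl
  have hlow : ∀ x ∈ S, a ≤ x := by
    rintro x (hx | hx)
    · exact hx.1.1.le
    · rw [hx]; exact hab
  have hbdd : BddBelow S := ⟨a, hlow⟩
  refine ⟨sInf S, ⟨le_csInf ⟨b, hSb⟩ hlow, csInf_le hbdd hSb⟩, ?_⟩
  have h1 : Ioc (sInf S) b ⊆ Ioc a b ∩ {x | τ < p x} := by
    intro x hx
    obtain ⟨y, hy, hyx⟩ := exists_lt_of_csInf_lt ⟨b, hSb⟩ hx.1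
    rcases hy with hy | hy
    · exact ⟨⟨hy.1.1.trans hyx, hx.2⟩, hy.2.trans_le (hp hyx.le)⟩
    · rw [hy] at hyx; exact absurd hx.2 hyx.not_ge
  have h2 : Ioc a b ∩ {x | τ < p x} ⊆ Icc (sInf S) b :=
    fun x hx => ⟨csInf_le hbdd (Or.inl hx), hx.1.2⟩
  exact Filter.EventuallyEq.symm (h1.eventuallyLE.antisymm
    (h2.eventuallyLE.trans_eq Ioc_ae_eq_Icc.symm))

/-- The second mean value theorem as an inequality, by the layer-cake formula for `p - p a`. -/
theorem abs_integral_monotone_mul_le {p φ : ℝ → ℝ} (hp : Monotone p) {a b M : ℝ} (hab : a ≤ b)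
    (hφ : IntervalIntegrable φ volume a b) (hM : ∀ c ∈ Icc a b, |∫ x in c..b, φ x| ≤ M) :
    |∫ x in a..b, (p x - p a) * φ x| ≤ M * (p b - p a) := by
  have hpab : p a ≤ p b := hp hab
  have hφ' : IntegrableOn φ (Ioc a b) := (intervalIntegrable_iff_integrableOn_Ioc_of_le hab).1 hφ
  set G : ℝ → ℝ → ℝ := fun x τ => (Ioi τ).indicator (fun _ => φ x) (p x) with hG
  have hmeas : MeasurableSet {z : ℝ × ℝ | z.2 < p z.1} :=
    measurableSet_lt measurable_snd (hp.measurable.comp measurable_fst)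
  have hGeq : Function.uncurry G = {z : ℝ × ℝ | z.2 < p z.1}.indicator (fun z => φ z.1) := by
    ext z
    simp [G, Function.uncurry, indicator]
  have hint : Integrable (Function.uncurry G)
      ((volume.restrict (Ioc a b)).prod (volume.restrict (Ioc (p a) (p b)))) := by
    rw [hGeq]
    exact (Integrable.comp_fst hφ' _).indicator hmeas
  -- Layer cake: `p x - p a` is the length of the set of levels `τ ∈ (p a, p b]` below `p x`.
  have hx : ∀ x ∈ Ioc a b, (p x - p a) * φ x = ∫ τ in Ioc (p a) (p b), G x τ := by
    intro x hx
    have h1 : ∀ τ, G x τ = (Iio (p x)).indicator (fun _ => φ x) τ := by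
      intro τ; simp [G, indicator]
    have h2 : (Ioc (p a) (p b) ∩ Iio (p x) : Set ℝ) =ᵐ[volume] Ioc (p a) (p x) := by
      have h3 : Ioc (p a) (p b) ∩ Iio (p x) = Ioo (p a) (p x) := by
        ext τ
        constructor
        · rintro ⟨h, h'⟩; exact ⟨h.1, h'⟩
        · rintro h; exact ⟨⟨h.1, h.2.le.trans (hp hx.2)⟩, h.2⟩
      rw [h3]
      exact Ioo_ae_eq_Ioc
    simp only [h1]
    rw [setIntegral_indicator measurableSet_Iio, setIntegral_congr_set h2, setIntegral_const]
    simp [measureReal_def, ENNReal.toReal_ofReal (sub_nonneg.2 (hp hx.1.le))]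
  have hτ : ∀ τ, |∫ x in Ioc a b, G x τ| ≤ M := by
    intro τ
    obtain ⟨c, hc, hce⟩ := exists_superlevel_ae_eq_Ioc hp hab τ
    have h1 : ∀ x, G x τ = {x | τ < p x}.indicator φ x := by
      intro x; simp [G, indicator]
    simp only [h1]
    rw [setIntegral_indicator (measurableSet_lt measurable_const hp.measurable),
      setIntegral_congr_set hce, ← intervalIntegral.integral_of_le hc.2]
    exact hM c hc
  rw [intervalIntegral.integral_of_le hab, setIntegral_congr_fun measurableSet_Ioc hx,
    integral_integral_swap hint]
  have h := norm_setIntegral_le_of_norm_le_const (μ := volume) (s := Ioc (p a) (p b))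
    (f := fun τ => ∫ x in Ioc a b, G x τ) (C := M) (by simp) (fun τ _ => hτ τ)
  simpa [measureReal_def, ENNReal.toReal_ofReal (sub_nonneg.2 hpab)] using h

theorem abs_integral_monotoneOn_mul_le {p φ : ℝ → ℝ} {a b M : ℝ} (hp : MonotoneOn p (Icc a b))
    (hab : a ≤ b) (hφ : IntervalIntegrable φ volume a b)
    (hM : ∀ c ∈ Icc a b, |∫ x in c..b, φ x| ≤ M) :
    |∫ x in a..b, (p x - p a) * φ x| ≤ M * (p b - p a) := by
  obtain ⟨q, hq, hqe⟩ := hp.exists_monotone_extension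
    (hp.map_bddBelow Subset.rfl ⟨a, fun x hx => hx.1, left_mem_Icc.2 hab⟩)
    (hp.map_bddAbove Subset.rfl ⟨b, fun x hx => hx.2, right_mem_Icc.2 hab⟩)
  rw [hqe (left_mem_Icc.2 hab), hqe (right_mem_Icc.2 hab)]
  refine le_trans (le_of_eq ?_) (abs_integral_monotone_mul_le hq hab hφ hM)
  congr 1
  refine intervalIntegral.integral_congr fun x hx => ?_
  rw [uIcc_of_le hab] at hx
  simp only [hqe hx]

theorem BoundedVariationOn.intervalIntegrable {D : ℝ → ℝ} {a b : ℝ} (hab : a ≤ b)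
    (hD : BoundedVariationOn D (Icc a b)) : IntervalIntegrable D volume a b := by
  obtain ⟨p, q, hp, hq, rfl⟩ :=
    hD.locallyBoundedVariationOn.exists_monotoneOn_sub_monotoneOn
  rw [← uIcc_of_le hab] at hp hq
  exact hp.intervalIntegrable.sub hq.intervalIntegrable

/-- `∫ (D - D(a)) φ` is at most the total variation of `D` times the largest tail integral
of `φ`. -/
theorem abs_integral_sub_mul_le_totalVar {D φ : ℝ → ℝ} {a b M : ℝ} (hab : a ≤ b)
    (hD : BoundedVariationOn D (Icc a b)) (hφ : ContinuousOn φ (Icc a b))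
    (hM : ∀ c ∈ Icc a b, |∫ x in c..b, φ x| ≤ M) :
    |∫ x in a..b, (D x - D a) * φ x| ≤ M * totalVar D a b := by
  have hDl := hD.locallyBoundedVariationOn
  have ha := left_mem_Icc.2 hab
  -- Jordan decomposition: `D = ((V + D) - (V - D)) / 2` with `V` the variation from `a`.
  have hp := variationOnFromTo.add_self_monotoneOn hDl ha
  have hq := variationOnFromTo.sub_self_monotoneOn hDl ha
  have hVa : variationOnFromTo D (Icc a b) a a = 0 := variationOnFromTo.self _ _ _
  have hVb : variationOnFromTo D (Icc a b) a b = totalVar D a b := by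
    rw [variationOnFromTo.eq_of_le _ _ hab, inter_self, totalVar]
  obtain ⟨V, hV⟩ : ∃ V, V = variationOnFromTo D (Icc a b) a := ⟨_, rfl⟩
  rw [← hV] at hp hq hVa hVb
  have hφ' := hφ
  rw [← uIcc_of_le hab] at hφ'
  have hφi : IntervalIntegrable φ volume a b := hφ'.intervalIntegrable
  have h1 := abs_integral_monotoneOn_mul_le hp hab hφi hM
  have h2 := abs_integral_monotoneOn_mul_le hq hab hφi hM
  rw [← uIcc_of_le hab] at hp hq
  have i1 : IntervalIntegrable (fun x => ((V + D) x - (V + D) a) * φ x) volume a b :=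
    (hp.intervalIntegrable.sub intervalIntegrable_const).mul_continuousOn hφ'
  have i2 : IntervalIntegrable (fun x => ((V - D) x - (V - D) a) * φ x) volume a b :=
    (hq.intervalIntegrable.sub intervalIntegrable_const).mul_continuousOn hφ'
  have h3 : ∫ x in a..b, (D x - D a) * φ x =
      ((∫ x in a..b, ((V + D) x - (V + D) a) * φ x) -
        ∫ x in a..b, ((V - D) x - (V - D) a) * φ x) / 2 := by
    rw [← intervalIntegral.integral_sub i1 i2, ← intervalIntegral.integral_div]
    refine intervalIntegral.integral_congr fun x _ => ?_
    simp only [Pi.add_apply, Pi.sub_apply]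
    ring
  rw [h3, abs_div, abs_two, div_le_iff₀ two_pos]
  refine (abs_sub _ _).trans ((add_le_add h1 h2).trans_eq ?_)
  simp only [Pi.add_apply, Pi.sub_apply, hVa, hVb]
  ring

theorem totalVar_mono {D : ℝ → ℝ} {a b c : ℝ} (hca : c ≤ a)
    (hD : BoundedVariationOn D (Icc c b)) : totalVar D a b ≤ totalVar D c b :=
  ENNReal.toReal_mono hD (eVariationOn.mono _ (Icc_subset_Icc_left hca))

theorem tendsto_rightLim_of_boundedVariationOn {D : ℝ → ℝ} {a b : ℝ} (hab : a < b)
    (hD : BoundedVariationOn D (Icc a b)) :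
    Tendsto D (𝓝[>] a) (𝓝 (Function.rightLim D a)) := by
  obtain ⟨l, hl⟩ := hD.exists_tendsto_right a
  have h : 𝓝[Icc a b ∩ Ioi a] a = 𝓝[>] a := by
    refine nhdsWithin_eq_nhdsWithin (s := Iio b) hab isOpen_Iio ?_
    ext x
    simp only [mem_inter_iff, mem_Icc, mem_Ioi, mem_Iio]
    constructor
    · rintro ⟨⟨_, h⟩, h'⟩; exact ⟨h, h'⟩
    · rintro ⟨h, h'⟩; exact ⟨⟨⟨h.le, h'.le⟩, h⟩, h'⟩
  rw [h] at hl
  rwa [rightLim_eq_of_tendsto hl]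

/-- The value of `D` at the endpoint `a` may be replaced by its one-sided limit, by applying the
previous bound on `[c, b]` and letting `c` decrease to `a`. -/
theorem abs_integral_mul_le_totalVar_add_rightLim {D φ : ℝ → ℝ} {a b M : ℝ} (hab : a < b)
    (hD : BoundedVariationOn D (Icc a b)) (hφ : ContinuousOn φ (Icc a b))
    (hM : ∀ c ∈ Icc a b, |∫ x in c..b, φ x| ≤ M) :
    |∫ x in a..b, D x * φ x| ≤ M * (totalVar D a b + |Function.rightLim D a|) := by
  have hM0 : 0 ≤ M := (abs_nonneg _).trans (hM b (right_mem_Icc.2 hab.le))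
  have hint : IntervalIntegrable (fun x => D x * φ x) volume a b :=
    (hD.intervalIntegrable hab.le).mul_continuousOn (by rwa [uIcc_of_le hab.le])
  have hle : ∀ c ∈ Ioo a b, |∫ x in c..b, D x * φ x| ≤ M * (totalVar D a b + |D c|) := by
    intro c hc
    have hsub : Icc c b ⊆ Icc a b := Icc_subset_Icc_left hc.1.le
    have hφc := hφ.mono hsub
    have h1 := abs_integral_sub_mul_le_totalVar hc.2.le (hD.mono hsub) hφc
      fun d hd => hM d (hsub hd)
    have h2 := hM c (Ioo_subset_Icc_self hc)
    rw [← uIcc_of_le hc.2.le] at hφc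
    have i1 : IntervalIntegrable (fun x => (D x - D c) * φ x) volume c b :=
      (((hD.mono hsub).intervalIntegrable hc.2.le).sub intervalIntegrable_const).mul_continuousOn
        hφc
    have h3 : ∫ x in c..b, D x * φ x =
        (∫ x in c..b, (D x - D c) * φ x) + D c * ∫ x in c..b, φ x := by
      rw [← intervalIntegral.integral_const_mul, ← intervalIntegral.integral_add i1
        (hφc.intervalIntegrable.const_mul _)]
      refine intervalIntegral.integral_congr fun x _ => ?_
      ring
    rw [h3]
    refine (abs_add_le _ _).trans ?_
    rw [abs_mul, mul_add]
    refine add_le_add (h1.trans ?_) ?_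
    · exact mul_le_mul_of_nonneg_left (totalVar_mono hc.1.le hD) hM0
    · rw [mul_comm]; exact mul_le_mul_of_nonneg_right h2 (abs_nonneg _)
  have hlim1 : Tendsto (fun c => |∫ x in c..b, D x * φ x|) (𝓝[>] a)
      (𝓝 |∫ x in a..b, D x * φ x|) := by
    have h1 : ContinuousOn (fun c => ∫ x in c..b, D x * φ x) (uIcc a b) :=
      intervalIntegral.continuousOn_primitive_interval_left
        ((intervalIntegrable_iff_integrableOn_Icc_of_le hab.le).1 hint |>.mono_set
          (uIcc_of_le hab.le).le)
    have h2 := (h1 a left_mem_uIcc).mono_left (nhdsWithin_le_iff.2 (show uIcc a b ∈ 𝓝[>] a by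
      rw [uIcc_of_le hab.le]; exact Icc_mem_nhdsGT hab))
    exact h2.abs
  have hlim2 : Tendsto (fun c => M * (totalVar D a b + |D c|)) (𝓝[>] a)
      (𝓝 (M * (totalVar D a b + |Function.rightLim D a|))) :=
    ((tendsto_rightLim_of_boundedVariationOn hab hD).abs.const_add _).const_mul _
  exact le_of_tendsto_of_tendsto hlim1 hlim2
    (eventually_of_mem (Ioo_mem_nhdsGT hab) hle)

end BoundedVariationIntegral

/-! ### Fractional integration by parts -/

section FractionalByParts

open Polynomial

/-- The Beta integral on `[x, 1]`. -/
theorem integral_sub_rpow_mul_one_sub_rpow {ρ c x : ℝ} (hρ : 0 < ρ) (hc : -1 < c) (hx : x < 1) :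
    ∫ y in x..1, (y - x) ^ (ρ - 1) * (1 - y) ^ c =
      Real.Gamma ρ * Real.Gamma (c + 1) / Real.Gamma (c + 1 + ρ) * (1 - x) ^ (c + ρ) := by
  have ha : 0 < 1 - x := by linarith
  have h1 := Complex.betaIntegral_scaled ρ ((c + 1 : ℝ) : ℂ) ha
  rw [Complex.betaIntegral_eq_Gamma_mul_div _ _ (by simpa using hρ)
    (by rw [Complex.ofReal_re]; linarith)] at h1
  have h2 : ∫ y in x..1, (y - x) ^ (ρ - 1) * (1 - y) ^ c =
      ∫ v in (0 : ℝ)..(1 - x), v ^ (ρ - 1) * (1 - x - v) ^ c := by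
    have h := intervalIntegral.integral_comp_sub_right (a := x) (b := 1)
      (fun v => v ^ (ρ - 1) * (1 - x - v) ^ c) x
    rw [sub_self] at h
    rw [← h]
    congr 1
    ext y
    congr 2
    ring
  have h3 : ∫ v in (0 : ℝ)..(1 - x), (v : ℂ) ^ ((ρ : ℂ) - 1) *
      (((1 - x : ℝ) : ℂ) - v) ^ (((c + 1 : ℝ) : ℂ) - 1) =
      ((∫ v in (0 : ℝ)..(1 - x), v ^ (ρ - 1) * (1 - x - v) ^ c : ℝ) : ℂ) := by
    rw [← intervalIntegral.integral_ofReal]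
    refine intervalIntegral.integral_congr fun v hv => ?_
    rw [uIcc_of_le ha.le] at hv
    rw [Complex.ofReal_mul, Complex.ofReal_cpow hv.1, Complex.ofReal_cpow (by linarith [hv.2])]
    push_cast
    congr 2
    ring
  rw [h2]
  rw [h3, ← Complex.ofReal_add, Complex.Gamma_ofReal, Complex.Gamma_ofReal, Complex.Gamma_ofReal,
    show ((ρ + (c + 1) : ℝ) : ℂ) - 1 = ((c + ρ : ℝ) : ℂ) by push_cast; ring,
    ← Complex.ofReal_cpow ha.le] at h1
  norm_cast at h1
  rw [h1, show ρ + (c + 1) = c + 1 + ρ by ring]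
  ring

/-- The semigroup law for fractional integrals of polynomials. -/
theorem integral_rpow_mul_fracPoly {ρ μ x : ℝ} (hρ : 0 < ρ) (hμ : 0 ≤ μ) (hx : x < 1)
    (p : ℝ[X]) :
    ∫ y in x..1, (y - x) ^ (ρ - 1) * fracPoly μ p (1 - y) =
      Real.Gamma ρ * fracPoly (μ + ρ) p (1 - x) := by
  have hint : ∀ q : ℝ[X], IntervalIntegrable
      (fun y => (y - x) ^ (ρ - 1) * fracPoly μ q (1 - y)) volume x 1 := by
    intro q
    have h1 : IntervalIntegrable (fun y : ℝ => (y - x) ^ (ρ - 1)) volume x 1 := by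
      have h := (intervalIntegral.intervalIntegrable_rpow' (a := 0) (b := 1 - x)
        (by linarith : -1 < ρ - 1)).comp_sub_right x
      simpa using h
    exact h1.mul_continuousOn
      ((continuous_fracPoly hμ q).comp (continuous_const.sub continuous_id)).continuousOn
  induction p using Polynomial.induction_on' with
  | add p q hp hq =>
    simp only [fracPoly_add, mul_add]
    rw [intervalIntegral.integral_add (hint p) (hint q), hp, hq]
  | monomial j b =>
    simp only [fracPoly_monomial]
    have h1 : ∀ y : ℝ, (y - x) ^ (ρ - 1) * (b * ((j.factorial : ℝ) *
        (Real.Gamma (j + 1 + μ))⁻¹ * (1 - y) ^ ((j : ℝ) + μ))) =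
        (b * ((j.factorial : ℝ) * (Real.Gamma (j + 1 + μ))⁻¹)) *
          ((y - x) ^ (ρ - 1) * (1 - y) ^ ((j : ℝ) + μ)) := by
      intro y; ring
    have hj : (0 : ℝ) ≤ j := j.cast_nonneg
    simp only [h1]
    rw [intervalIntegral.integral_const_mul,
      integral_sub_rpow_mul_one_sub_rpow hρ (by linarith) hx,
      show (j : ℝ) + μ + 1 = j + 1 + μ by ring, ← add_assoc, ← add_assoc]
    have h2 := Real.Gamma_pos_of_pos (by positivity : 0 < (j : ℝ) + 1 + μ)
    field_simp

theorem integral_fracPoly_one_sub {μ c : ℝ} (hμ : 0 ≤ μ) (hc : c ≤ 1) (p : ℝ[X]) :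
    ∫ x in c..1, fracPoly μ p (1 - x) = fracPoly (μ + 1) p (1 - c) := by
  have h1 : Continuous fun x : ℝ => fracPoly μ p (1 - x) :=
    (continuous_fracPoly hμ p).comp (continuous_const.sub continuous_id)
  have h2 : Continuous fun x : ℝ => -fracPoly (μ + 1) p (1 - x) :=
    ((continuous_fracPoly (by linarith) p).comp (continuous_const.sub continuous_id)).neg
  rw [intervalIntegral.integral_eq_sub_of_hasDerivAt_of_le hc h2.continuousOn (fun x hx => ?_)
    (h1.intervalIntegrable _ _), sub_self, fracPoly_at_zero (by linarith)]
  · ring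
  · have h3 := (hasDerivAt_fracPoly (μ + 1) p (by linarith [hx.2] : 0 < 1 - x)).comp x
      ((hasDerivAt_id x).const_sub 1)
    rw [add_sub_cancel_right] at h3
    refine h3.neg.congr_deriv ?_
    ring

/-- Fubini's theorem for a triangular convolution kernel. -/
theorem integral_mul_integral_rpow_swap {f g : ℝ → ℝ} {θ ρ : ℝ} (hθ : θ ≤ 1) (hρ : 0 < ρ)
    (hf : IntervalIntegrable f volume θ 1) (hg : Continuous g) :
    ∫ y in θ..1, f y * ∫ x in y..1, (x - y) ^ (ρ - 1) * g x =
      ∫ x in θ..1, (∫ y in θ..x, f y / (x - y) ^ (1 - ρ)) * g x := by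
  -- Extended by zero, `f` and the kernel are integrable on the line, so that their convolution
  -- integrand is integrable on the plane.
  set F : ℝ → ℝ := (Ioc θ 1).indicator f with hF
  set K : ℝ → ℝ := (Icc 0 (1 - θ)).indicator (fun z => z ^ (ρ - 1)) with hK
  set G : ℝ → ℝ := (Icc θ 1).indicator g with hG
  have hFi : Integrable F := by
    rw [hF, integrable_indicator_iff measurableSet_Ioc]
    exact (intervalIntegrable_iff_integrableOn_Ioc_of_le hθ).1 hf
  have hKi : Integrable K := by
    rw [hK, integrable_indicator_iff measurableSet_Icc]
    exact (intervalIntegrable_iff_integrableOn_Icc_of_le (by linarith)).1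
      (intervalIntegral.intervalIntegrable_rpow' (by linarith))
  obtain ⟨C, hC⟩ : ∃ C, ∀ x, ‖G x‖ ≤ C := by
    obtain ⟨C, hC⟩ := isCompact_Icc.exists_bound_of_continuousOn (hg.continuousOn (s := Icc θ 1))
    refine ⟨max C 0, fun x => ?_⟩
    by_cases hx : x ∈ Icc θ 1
    · rw [hG, indicator_of_mem hx]; exact (hC x hx).trans (le_max_left _ _)
    · rw [hG, indicator_of_notMem hx]; simp
  have hconv := hFi.convolution_integrand (ContinuousLinearMap.mul ℝ ℝ) hKi
  have hint : Integrable (fun z : ℝ × ℝ => G z.1 * (F z.2 * K (z.1 - z.2)))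
      (volume.prod volume) :=
    hconv.bdd_mul (c := C)
      ((hg.measurable.indicator measurableSet_Icc).comp measurable_fst).aestronglyMeasurable
      (.of_forall fun z => hC z.1)
  have hswap := integral_integral_swap (f := fun x y => G x * (F y * K (x - y))) hint
  have hleft : ∫ y, ∫ x, G x * (F y * K (x - y)) =
      ∫ y in θ..1, f y * ∫ x in y..1, (x - y) ^ (ρ - 1) * g x := by
    rw [intervalIntegral.integral_of_le hθ, ← integral_indicator measurableSet_Ioc]
    refine integral_congr_ae (.of_forall fun y => ?_)
    by_cases hy : y ∈ Ioc θ 1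
    · simp only [indicator_of_mem hy]
      rw [intervalIntegral.integral_of_le hy.2, ← integral_Icc_eq_integral_Ioc,
        ← integral_const_mul, ← integral_indicator measurableSet_Icc]
      refine integral_congr_ae (.of_forall fun x => ?_)
      by_cases hx : x ∈ Icc y 1
      · have h1 : x ∈ Icc θ 1 := ⟨hy.1.le.trans hx.1, hx.2⟩
        have h2 : x - y ∈ Icc 0 (1 - θ) := ⟨by linarith [hx.1], by linarith [hx.2, hy.1]⟩
        simp only [hG, hF, hK, indicator_of_mem hx, indicator_of_mem h1, indicator_of_mem h2,
          indicator_of_mem hy]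
        ring
      · simp only [indicator_of_notMem hx]
        by_cases h1 : x ∈ Icc θ 1
        · have h2 : x - y ∉ Icc 0 (1 - θ) := fun h => hx ⟨by linarith [h.1], h1.2⟩
          simp [hK, indicator_of_notMem h2]
        · simp [hG, indicator_of_notMem h1]
    · simp [hF, indicator_of_notMem hy]
  have hright : ∫ x, ∫ y, G x * (F y * K (x - y)) =
      ∫ x in θ..1, (∫ y in θ..x, f y / (x - y) ^ (1 - ρ)) * g x := by
    rw [intervalIntegral.integral_of_le hθ, ← integral_Icc_eq_integral_Ioc,
      ← integral_indicator measurableSet_Icc]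
    refine integral_congr_ae (.of_forall fun x => ?_)
    by_cases hx : x ∈ Icc θ 1
    · simp only [indicator_of_mem hx]
      rw [intervalIntegral.integral_of_le hx.1, mul_comm, ← integral_const_mul,
        ← integral_indicator measurableSet_Ioc]
      refine integral_congr_ae (.of_forall fun y => ?_)
      by_cases hy : y ∈ Ioc θ x
      · have h1 : y ∈ Ioc θ 1 := ⟨hy.1, hy.2.trans hx.2⟩
        have h2 : x - y ∈ Icc 0 (1 - θ) := ⟨by linarith [hy.2], by linarith [hx.2, hy.1]⟩
        simp only [hG, hF, hK, indicator_of_mem hx, indicator_of_mem h1, indicator_of_mem h2,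
          indicator_of_mem hy]
        rw [show ρ - 1 = -(1 - ρ) by ring, Real.rpow_neg h2.1, div_eq_mul_inv]
      · simp only [indicator_of_notMem hy]
        by_cases h1 : y ∈ Ioc θ 1
        · have h2 : x - y ∉ Icc 0 (1 - θ) := fun h => hy ⟨h1.1, by linarith [h.1]⟩
          simp [hK, indicator_of_notMem h2]
        · simp [hF, indicator_of_notMem h1]
    · simp [hG, indicator_of_notMem hx]
  rw [← hleft, ← hright]
  exact hswap.symm

/-- If the left-sided fractional integral of order `ρ` of `f` agrees almost everywhere with a
function `D` of bounded variation, then pairing `f` with the fractional integral of order `μ + ρ`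
of a polynomial is controlled by `D` and the fractional integral of order `μ + 1`. -/
theorem abs_integral_mul_fracPoly_le {f D : ℝ → ℝ} {θ ρ μ M : ℝ} (hθ : θ ∈ Ioo (-1 : ℝ) 1)
    (hρ : 0 < ρ) (hμ : 0 ≤ μ) (p : ℝ[X]) (hf : IntervalIntegrable f volume θ 1)
    (hD : IsBVRep D (rlIntegralLeft ρ θ f) θ 1)
    (hM : ∀ t ∈ Icc (0 : ℝ) 2, |fracPoly (μ + 1) p t| ≤ M) :
    |∫ y in θ..1, f y * fracPoly (μ + ρ) p (1 - y)| ≤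
      M * (totalVar D θ 1 + |Function.rightLim D θ|) := by
  have hg : Continuous fun x : ℝ => fracPoly μ p (1 - x) :=
    (continuous_fracPoly hμ p).comp (continuous_const.sub continuous_id)
  have hΓ := Real.Gamma_pos_of_pos hρ
  have h1 : ∫ y in θ..1, f y * fracPoly (μ + ρ) p (1 - y) =
      ∫ x in θ..1, D x * fracPoly μ p (1 - x) := by
    have h2 : ∫ y in θ..1, f y * fracPoly (μ + ρ) p (1 - y) =
        1 / Real.Gamma ρ * ∫ y in θ..1, f y * ∫ x in y..1,
          (x - y) ^ (ρ - 1) * fracPoly μ p (1 - x) := by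
      rw [← intervalIntegral.integral_const_mul]
      refine intervalIntegral.integral_congr fun y hy => ?_
      rw [uIcc_of_le hθ.2.le] at hy
      rcases hy.2.lt_or_eq with h | h
      · rw [integral_rpow_mul_fracPoly hρ hμ h]
        field_simp
      · simp [h, fracPoly_at_zero (by linarith : 0 < μ + ρ)]
    rw [h2, integral_mul_integral_rpow_swap hθ.2.le hρ hf hg,
      ← intervalIntegral.integral_const_mul]
    refine intervalIntegral.integral_congr_ae_restrict ?_
    rw [uIoc_of_le hθ.2.le]
    have h3 := ae_mono (Measure.restrict_mono Ioc_subset_Icc_self le_rfl) hD.1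
    filter_upwards [h3] with x hx
    rw [hx, rlIntegralLeft]
    ring
  rw [h1]
  refine abs_integral_mul_le_totalVar_add_rightLim hθ.2 hD.2 hg.continuousOn fun c hc => ?_
  rw [integral_fracPoly_one_sub hμ hc.2]
  exact hM _ ⟨by linarith [hc.2], by linarith [hc.1, hθ.1]⟩

end FractionalByParts

/-! ### Orthogonality and the Legendre projection -/

section Orthogonality

open Polynomial

theorem intervalIntegrable_eval_mul_eval (p q : ℝ[X]) (a b : ℝ) :
    IntervalIntegrable (fun x => p.eval x * q.eval x) volume a b :=
  (p.continuous.mul q.continuous).intervalIntegrable _ _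

theorem integral_eval_mul_eval_derivative (p q : ℝ[X]) (a b : ℝ) :
    ∫ x in a..b, p.eval x * (derivative q).eval x =
      p.eval b * q.eval b - p.eval a * q.eval a - ∫ x in a..b, (derivative p).eval x * q.eval x :=
  intervalIntegral.integral_mul_deriv_eq_deriv_mul (fun x _ => p.hasDerivAt x)
    (fun x _ => q.hasDerivAt x) ((derivative p).continuous.intervalIntegrable _ _)
    ((derivative q).continuous.intervalIntegrable _ _)

/-- Integrating by parts `m` times moves `m` derivatives onto `q`; the boundary terms vanish. -/
theorem integral_mul_legendreAntideriv_eq_zero {n : ℕ} (m : ℕ) (q : ℝ[X]) (j : ℕ)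
    (hq : derivative^[m] q = 0) (hj : j + m ≤ n) :
    ∫ x in (-1 : ℝ)..1, q.eval x * (legendreAntideriv n j).eval x = 0 := by
  induction m generalizing q j with
  | zero =>
    have : q = 0 := hq
    simp [this]
  | succ m ih =>
    rw [← derivative_legendreAntideriv (by omega : j + 1 ≤ n), integral_eval_mul_eval_derivative,
      eval_legendreAntideriv_of_sq_eq_one (by omega) (by omega) (by norm_num),
      eval_legendreAntideriv_of_sq_eq_one (by omega) (by omega) (by norm_num),
      ih _ _ hq (by omega)]
    ring

theorem integral_mul_legendreP_eq_zero {n : ℕ} {q : ℝ[X]} (hq : q.natDegree < n) :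
    ∫ x in (-1 : ℝ)..1, q.eval x * (legendreP n).eval x = 0 :=
  integral_mul_legendreAntideriv_eq_zero n q 0 (iterate_derivative_eq_zero hq) (by omega)

theorem integral_legendreP_mul_legendreP_of_ne {m n : ℕ} (h : m ≠ n) :
    ∫ x in (-1 : ℝ)..1, (legendreP m).eval x * (legendreP n).eval x = 0 := by
  rcases h.lt_or_gt with h | h
  · exact integral_mul_legendreP_eq_zero ((natDegree_legendreP_le m).trans_lt h)
  · simp only [mul_comm ((legendreP m).eval _)]
    exact integral_mul_legendreP_eq_zero ((natDegree_legendreP_le n).trans_lt h)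

theorem integral_sq_legendreP (n : ℕ) :
    ∫ x in (-1 : ℝ)..1, (legendreP n).eval x * (legendreP n).eval x = 2 / (2 * n + 1) := by
  cases n with
  | zero => simp [legendreP_zero]; norm_num
  | succ n =>
    have h1 : ∀ x : ℝ, (legendreP (n + 1)).eval x * (derivative (legendreP (n + 2))).eval x =
        (derivative (legendreP n)).eval x * (legendreP (n + 1)).eval x +
          (2 * n + 3) * ((legendreP (n + 1)).eval x * (legendreP (n + 1)).eval x) := by
      intro x
      rw [derivative_legendreP_add_two]
      simp
      ring
    have h2 := integral_eval_mul_eval_derivative (legendreP (n + 1)) (legendreP (n + 2)) (-1) 1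
    have h3 : ∀ m : ℕ, (derivative (legendreP m)).natDegree ≤ m - 1 := fun m =>
      (natDegree_derivative_le _).trans (Nat.sub_le_sub_right (natDegree_legendreP_le m) 1)
    rw [integral_mul_legendreP_eq_zero (by have := h3 (n + 1); omega)] at h2
    simp only [h1] at h2
    rw [intervalIntegral.integral_add (intervalIntegrable_eval_mul_eval _ _ _ _)
      ((intervalIntegrable_eval_mul_eval _ _ _ _).const_mul _),
      intervalIntegral.integral_const_mul,
      integral_mul_legendreP_eq_zero (by have := h3 n; omega), eval_one_legendreP,
      eval_one_legendreP, eval_neg_legendreP, eval_neg_legendreP, eval_one_legendreP,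
      eval_one_legendreP, mul_one, mul_one, mul_one, ← pow_add,
      show n + 1 + (n + 2) = 2 * (n + 1) + 1 by ring, pow_succ, pow_mul] at h2
    have h4 : (0 : ℝ) < 2 * n + 3 := by positivity
    push_cast
    rw [eq_div_iff (by positivity)]
    norm_num at h2
    linarith

/-- The Legendre projection, as a polynomial. -/
noncomputable def legendreProjPoly (N : ℕ) (u : ℝ → ℝ) : ℝ[X] :=
  ∑ n ∈ Finset.range (N + 1), C (legendreCoeff u n) * legendreP n

theorem eval_legendreProjPoly (N : ℕ) (u : ℝ → ℝ) (x : ℝ) :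
    (legendreProjPoly N u).eval x = legendreProj N u x := by
  simp [legendreProjPoly, legendreProj, eval_finsetSum]

theorem continuous_legendreProj (N : ℕ) (u : ℝ → ℝ) : Continuous (legendreProj N u) := by
  simpa only [eval_legendreProjPoly] using (legendreProjPoly N u).continuous

theorem degree_legendreProjPoly_lt (N : ℕ) (u : ℝ → ℝ) :
    (legendreProjPoly N u).degree < (N + 1 : ℕ) := by
  rw [← mem_degreeLT]
  refine Submodule.sum_mem _ fun n hn => ?_
  rw [mem_degreeLT]
  have h1 := Finset.mem_range.1 hn
  refine lt_of_le_of_lt (degree_le_of_natDegree_le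
    ((natDegree_C_mul_le _ _).trans (natDegree_legendreP_le n))) ?_
  exact_mod_cast h1

theorem continuousOn_projError {u : ℝ → ℝ} (hu : ContinuousOn u (Icc (-1) 1)) (N : ℕ) :
    ContinuousOn (projError N u) (Icc (-1) 1) :=
  hu.sub (continuous_legendreProj N u).continuousOn

theorem intervalIntegrable_mul_eval {f : ℝ → ℝ} (hf : ContinuousOn f (Icc (-1) 1)) (p : ℝ[X]) :
    IntervalIntegrable (fun x => f x * p.eval x) volume (-1) 1 := by
  rw [← uIcc_of_le (by norm_num : (-1 : ℝ) ≤ 1)] at hf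
  exact (hf.mul p.continuous.continuousOn).intervalIntegrable

theorem integral_projError_mul_legendreP {u : ℝ → ℝ} (hu : ContinuousOn u (Icc (-1) 1))
    {m N : ℕ} (hm : m ≤ N) :
    ∫ x in (-1 : ℝ)..1, projError N u x * (legendreP m).eval x = 0 := by
  have h0 : ∀ n ∈ Finset.range (N + 1), IntervalIntegrable (fun x =>
      legendreCoeff u n * ((legendreP n).eval x * (legendreP m).eval x)) volume (-1) 1 :=
    fun n _ => (intervalIntegrable_eval_mul_eval _ _ _ _).const_mul _
  have h00 : IntervalIntegrable (fun x => ∑ n ∈ Finset.range (N + 1),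
      legendreCoeff u n * ((legendreP n).eval x * (legendreP m).eval x)) volume (-1) 1 := by
    simpa only [Finset.sum_fn] using IntervalIntegrable.sum _ h0
  have h1 : ∀ x, projError N u x * (legendreP m).eval x = u x * (legendreP m).eval x -
      ∑ n ∈ Finset.range (N + 1),
        legendreCoeff u n * ((legendreP n).eval x * (legendreP m).eval x) := by
    intro x
    simp only [projError, legendreProj, sub_mul, Finset.sum_mul, mul_assoc]
  simp only [h1]
  rw [intervalIntegral.integral_sub (intervalIntegrable_mul_eval hu _) h00,
    intervalIntegral.integral_finsetSum h0]
  simp only [intervalIntegral.integral_const_mul]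
  rw [Finset.sum_eq_single m (fun n _ hn => by
      rw [integral_legendreP_mul_legendreP_of_ne hn, mul_zero])
    (fun h => absurd (Finset.mem_range.2 (by omega)) h), integral_sq_legendreP, legendreCoeff]
  field_simp
  ring

/-- The projection error is orthogonal to polynomials of degree at most `N`, by induction on the
degree, the leading term being removed by a multiple of a Legendre polynomial. -/
theorem integral_projError_mul_eq_zero {u : ℝ → ℝ} (hu : ContinuousOn u (Icc (-1) 1)) {N d : ℕ}
    (hd : d ≤ N + 1) (q : ℝ[X]) (hq : q.degree < d) :
    ∫ x in (-1 : ℝ)..1, projError N u x * q.eval x = 0 := by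
  induction d generalizing q with
  | zero =>
    have : q = 0 := by simpa using hq
    simp [this]
  | succ d ih =>
    set a := q.coeff d / (legendreP d).coeff d with ha
    set r := q - C a * legendreP d with hr
    have hrd : r.degree < d := by
      rw [degree_lt_iff_coeff_zero] at hq ⊢
      intro m hm
      rw [hr, coeff_sub, coeff_C_mul]
      rcases hm.eq_or_lt with h | h
      · rw [← h, ha, div_mul_cancel₀ _ (coeff_legendreP_self_ne_zero d), sub_self]
      · rw [hq m (by omega),
          coeff_eq_zero_of_natDegree_lt ((natDegree_legendreP_le d).trans_lt h)]
        ring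
    have h1 : ∀ x, projError N u x * q.eval x =
        projError N u x * r.eval x + a * (projError N u x * (legendreP d).eval x) := by
      intro x
      simp only [hr, eval_sub, eval_mul, eval_C]
      ring
    have hc := continuousOn_projError hu N
    simp only [h1]
    rw [intervalIntegral.integral_add (intervalIntegrable_mul_eval hc _)
      ((intervalIntegrable_mul_eval hc _).const_mul _),
      intervalIntegral.integral_const_mul, ih (by omega) r hrd,
      integral_projError_mul_legendreP hu (by omega)]
    ring

/-- The projection is the best approximation in `L²(-1, 1)`. -/
theorem integral_sq_projError_le {u : ℝ → ℝ} (hu : ContinuousOn u (Icc (-1) 1)) {N : ℕ}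
    (q : ℝ[X]) (hq : q.natDegree ≤ N) :
    ∫ x in (-1 : ℝ)..1, projError N u x ^ 2 ≤ ∫ x in (-1 : ℝ)..1, (u x - q.eval x) ^ 2 := by
  set r := legendreProjPoly N u - q with hr
  have hrd : r.degree < (N + 1 : ℕ) := by
    refine lt_of_le_of_lt (degree_sub_le _ _) (max_lt (degree_legendreProjPoly_lt N u) ?_)
    refine lt_of_le_of_lt (degree_le_of_natDegree_le hq) ?_
    exact_mod_cast Nat.lt_succ_self N
  have h1 : ∀ x, (u x - q.eval x) ^ 2 =
      projError N u x ^ 2 + (2 * (projError N u x * r.eval x) + r.eval x ^ 2) := by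
    intro x
    simp only [hr, eval_sub, eval_legendreProjPoly, projError]
    ring
  have hc := continuousOn_projError hu N
  have i1 := intervalIntegrable_mul_eval hc r
  have i2 : IntervalIntegrable (fun x => r.eval x ^ 2) volume (-1) 1 :=
    (r.continuous.pow 2).intervalIntegrable _ _
  rw [← uIcc_of_le (by norm_num : (-1 : ℝ) ≤ 1)] at hc
  have i3 : IntervalIntegrable (fun x => projError N u x ^ 2) volume (-1) 1 :=
    (hc.pow 2).intervalIntegrable
  simp only [h1]
  rw [intervalIntegral.integral_add i3 ((i1.const_mul 2).add i2),
    intervalIntegral.integral_add (i1.const_mul 2) i2, intervalIntegral.integral_const_mul,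
    integral_projError_mul_eq_zero hu le_rfl r hrd]
  have : 0 ≤ ∫ x in (-1 : ℝ)..1, r.eval x ^ 2 :=
    intervalIntegral.integral_nonneg (by norm_num) fun x _ => sq_nonneg _
  linarith

/-- Completeness of the Legendre polynomials in `L²(-1, 1)`, for continuous functions. -/
theorem exists_integral_sq_projError_le {u : ℝ → ℝ} (hu : ContinuousOn u (Icc (-1) 1)) {ε : ℝ}
    (hε : 0 < ε) : ∃ N₀ : ℕ, ∀ N, N₀ ≤ N → ∫ x in (-1 : ℝ)..1, projError N u x ^ 2 ≤ ε := by
  obtain ⟨p, hp⟩ := exists_polynomial_near_of_continuousOn (-1) 1 u hu (√(ε / 2))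
    (Real.sqrt_pos.2 (by positivity))
  refine ⟨p.natDegree, fun N hN => (integral_sq_projError_le hu p hN).trans ?_⟩
  have h1 : ∀ x ∈ Icc (-1 : ℝ) 1, (u x - p.eval x) ^ 2 ≤ ε / 2 := by
    intro x hx
    have h := (hp x hx).le
    rw [abs_sub_comm] at h
    rw [← sq_abs, ← Real.sq_sqrt (by positivity : 0 ≤ ε / 2)]
    exact pow_le_pow_left₀ (abs_nonneg _) h 2
  have hc : ContinuousOn (fun x => (u x - p.eval x) ^ 2) (uIcc (-1) 1) := by
    rw [uIcc_of_le (by norm_num : (-1 : ℝ) ≤ 1)]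
    exact (hu.sub p.continuous.continuousOn).pow 2
  refine (intervalIntegral.integral_mono_on (by norm_num) hc.intervalIntegrable
    intervalIntegrable_const h1).trans_eq ?_
  rw [intervalIntegral.integral_const, smul_eq_mul]
  ring

/-- A weighted bound for all partial sums of the tail of the Legendre series is a bound for the
projection error. The excess of the error over the bound is dominated by `|u - π_M u|` for every
large `M`, so it vanishes in `L²`. -/
theorem ae_weighted_projError_le {u ω : ℝ → ℝ} (hu : ContinuousOn u (Icc (-1) 1))
    (hω : Continuous ω) (hω0 : ∀ x, 0 ≤ ω x) (hω1 : ∀ x, ω x ≤ 1) {N : ℕ} {S : ℝ}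
    (hS : ∀ M, N ≤ M → ∀ x ∈ Ioo (-1 : ℝ) 1,
      ω x * |legendreProj M u x - legendreProj N u x| ≤ S) :
    ∀ᵐ x ∂volume.restrict (Ioo (-1 : ℝ) 1), ω x * |projError N u x| ≤ S := by
  set h : ℝ → ℝ := fun x => max (ω x * |projError N u x| - S) 0 ^ 2 with hh
  have hc : ContinuousOn h (Icc (-1) 1) :=
    (((hω.continuousOn.mul (continuousOn_projError hu N).abs).sub continuousOn_const).sup
      continuousOn_const).pow 2
  rw [← uIcc_of_le (by norm_num : (-1 : ℝ) ≤ 1)] at hc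
  have hle : ∫ x in (-1 : ℝ)..1, h x ≤ 0 := by
    refine le_of_forall_pos_le_add fun ε hε => ?_
    obtain ⟨N₀, hN₀⟩ := exists_integral_sq_projError_le hu hε
    set M := max N N₀
    refine le_trans ?_ ((hN₀ M (le_max_right _ _)).trans_eq (zero_add ε).symm)
    have hcM := continuousOn_projError hu M
    rw [← uIcc_of_le (by norm_num : (-1 : ℝ) ≤ 1)] at hcM
    refine intervalIntegral.integral_mono_on_of_le_Ioo (by norm_num) hc.intervalIntegrable
      (hcM.pow 2).intervalIntegrable fun x hx => ?_
    rw [← sq_abs (projError M u x)]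
    refine pow_le_pow_left₀ (le_max_right _ _) (max_le ?_ (abs_nonneg _)) 2
    have h1 : |projError N u x| ≤
        |projError M u x| + |legendreProj M u x - legendreProj N u x| := by
      refine le_trans (le_of_eq ?_) (abs_add_le _ _)
      congr 1
      simp only [projError]
      ring
    have h2 := mul_le_mul_of_nonneg_left h1 (hω0 x)
    have h3 := hS M (le_max_left _ _) x hx
    have h4 := mul_le_mul_of_nonneg_right (hω1 x) (abs_nonneg (projError M u x))
    rw [mul_add] at h2
    linarith
  have hnn : ∀ x, 0 ≤ h x := fun x => sq_nonneg _
  have hzero : ∫ x in (-1 : ℝ)..1, h x = 0 :=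
    hle.antisymm (intervalIntegral.integral_nonneg (by norm_num) fun x _ => hnn x)
  rw [intervalIntegral.integral_eq_zero_iff_of_le_of_nonneg_ae (by norm_num)
    (.of_forall hnn) hc.intervalIntegrable] at hzero
  filter_upwards [ae_mono (Measure.restrict_mono Ioo_subset_Ioc_self le_rfl) hzero] with x hx
  have h1 : max (ω x * |projError N u x| - S) 0 = 0 := by
    simpa [hh] using hx
  linarith [le_max_left (ω x * |projError N u x| - S) 0]

end Orthogonality

/-! ### Bounds for the Legendre coefficients -/

section CoefficientBounds

open Polynomial

/-- For integer orders the fractional integral of `P_n` is, up to a sign, its Rodrigues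
antiderivative. -/
theorem fracPoly_natCast_legendreT {n j : ℕ} (h : j ≤ n) {c : ℝ} (hc : c ≤ 1) :
    fracPoly j (legendreT n) (1 - c) = (-1) ^ j * (legendreAntideriv n j).eval c := by
  induction j generalizing c with
  | zero =>
    rw [Nat.cast_zero, fracPoly_order_zero, eval_legendreT, sub_sub_cancel, legendreAntideriv_zero]
    ring
  | succ j ih =>
    have h1 : ∫ x in c..1, fracPoly j (legendreT n) (1 - x) =
        ∫ x in c..1, (-1) ^ j * (derivative (legendreAntideriv n (j + 1))).eval x := by
      refine intervalIntegral.integral_congr fun x hx => ?_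
      rw [uIcc_of_le hc] at hx
      rw [derivative_legendreAntideriv h]
      exact ih (by omega) hx.2
    have h2 : ∫ x in c..1, (derivative (legendreAntideriv n (j + 1))).eval x =
        (legendreAntideriv n (j + 1)).eval 1 - (legendreAntideriv n (j + 1)).eval c :=
      intervalIntegral.integral_eq_sub_of_hasDerivAt (fun x _ => Polynomial.hasDerivAt _ x)
        ((Polynomial.continuous _).intervalIntegrable _ _)
    rw [Nat.cast_succ, ← integral_fracPoly_one_sub j.cast_nonneg hc, h1,
      intervalIntegral.integral_const_mul, h2,
      eval_legendreAntideriv_of_sq_eq_one (by omega) h (by norm_num)]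
    ring

/-- Parity of the integer order integrals of `P_n`. It lets the part of `[-1, 1]` to the left of `θ`
be reflected onto the part to the right of `-θ`. -/
theorem fracPoly_legendreT_one_add {n j : ℕ} (h : j ≤ n) {x : ℝ} (hx : x ∈ Icc (-1 : ℝ) 1) :
    fracPoly j (legendreT n) (1 + x) = (-1) ^ (n + j) * fracPoly j (legendreT n) (1 - x) := by
  rw [← sub_neg_eq_add, fracPoly_natCast_legendreT h (by linarith [hx.1]),
    fracPoly_natCast_legendreT h hx.2, eval_neg_legendreAntideriv h]
  ring

theorem ae_deriv_derivOn (j : ℕ) (u : ℝ → ℝ) :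
    ∀ᵐ x ∂volume.restrict (uIoc (-1 : ℝ) 1), deriv (derivOn j u) x = derivOn (j + 1) u x := by
  rw [uIoc_of_le (by norm_num), ← restrict_Ioo_eq_restrict_Ioc]
  filter_upwards [ae_restrict_mem measurableSet_Ioo] with x hx
  rw [derivOn, derivOn, iteratedDerivWithin_succ,
    derivWithin_of_mem_nhds (Icc_mem_nhds hx.1 hx.2)]

theorem intervalIntegrable_derivOn {k : ℕ} (hk : 1 ≤ k) {u : ℝ → ℝ} (hu : ACDerivs k u) :
    IntervalIntegrable (derivOn k u) volume (-1) 1 := by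
  obtain ⟨j, rfl⟩ : ∃ j, k = j + 1 := ⟨k - 1, by omega⟩
  exact (hu.2 j (by omega)).intervalIntegrable_deriv.congr_ae (ae_deriv_derivOn j u)

theorem continuousOn_of_ACDerivs {k : ℕ} (hk : 1 ≤ k) {u : ℝ → ℝ} (hu : ACDerivs k u) :
    ContinuousOn u (Icc (-1) 1) := by
  have h := (hu.2 0 hk).continuousOn
  rw [uIcc_of_le (by norm_num)] at h
  simpa [derivOn] using h

/-- Repeated integration by parts: the antiderivatives of `P_n` vanish at `±1`. -/
theorem integral_mul_legendreP_eq_integral_derivOn {k n j : ℕ} {u : ℝ → ℝ} (hu : ACDerivs k u)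
    (hj : j ≤ k) (hn : j ≤ n) :
    ∫ x in (-1 : ℝ)..1, u x * (legendreP n).eval x =
      (-1) ^ j * ∫ x in (-1 : ℝ)..1, derivOn j u x * (legendreAntideriv n j).eval x := by
  induction j with
  | zero => simp [derivOn, legendreAntideriv_zero]
  | succ j ih =>
    have hg : AbsolutelyContinuousOnInterval
        (fun x => (legendreAntideriv n (j + 1)).eval x) (-1) 1 :=
      ContDiffOn.absolutelyContinuousOnInterval
        (by
          have h := contDiff_aeval (𝕜 := ℝ) (legendreAntideriv n (j + 1)) 1
          simp only [coe_aeval_eq_eval] at h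
          exact h.contDiffOn)
    have h1 := (hu.2 j hj).integral_mul_deriv_eq_deriv_mul hg
    have h2 : ∀ x, deriv (fun x => (legendreAntideriv n (j + 1)).eval x) x =
        (legendreAntideriv n j).eval x := by
      intro x
      rw [Polynomial.deriv, derivative_legendreAntideriv hn]
    have h3 : ∫ x in (-1 : ℝ)..1, deriv (derivOn j u) x * (legendreAntideriv n (j + 1)).eval x =
        ∫ x in (-1 : ℝ)..1, derivOn (j + 1) u x * (legendreAntideriv n (j + 1)).eval x := by
      refine intervalIntegral.integral_congr_ae_restrict ?_
      filter_upwards [ae_deriv_derivOn j u] with x hx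
      rw [hx]
    simp only [h2] at h1
    rw [ih (by omega) (by omega), h1, h3,
      eval_legendreAntideriv_of_sq_eq_one (by omega) hn (by norm_num),
      eval_legendreAntideriv_of_sq_eq_one (by omega) hn (by norm_num)]
    ring

/-- The `k`-fold integral of `P_n` from the right pairs with `u^{(k)}`. -/
theorem integral_mul_legendreP_eq_integral_fracPoly {k n : ℕ} {u : ℝ → ℝ} (hu : ACDerivs k u)
    (hn : k ≤ n) :
    ∫ x in (-1 : ℝ)..1, u x * (legendreP n).eval x =
      ∫ x in (-1 : ℝ)..1, derivOn k u x * fracPoly k (legendreT n) (1 - x) := by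
  rw [integral_mul_legendreP_eq_integral_derivOn hu le_rfl hn,
    ← intervalIntegral.integral_const_mul]
  refine intervalIntegral.integral_congr fun x hx => ?_
  rw [uIcc_of_le (by norm_num)] at hx
  rw [fracPoly_natCast_legendreT hn hx.2]
  ring

theorem image_neg_Icc_neg (a b : ℝ) : (fun x : ℝ => -x) '' Icc (-b) (-a) = Icc a b := by
  simp

theorem eVariationOn_comp_neg (D : ℝ → ℝ) (a b : ℝ) :
    eVariationOn (fun x => D (-x)) (Icc (-b) (-a)) = eVariationOn D (Icc a b) := by
  have h := eVariationOn.comp_eq_of_antitoneOn D (t := Icc (-b) (-a)) (fun x : ℝ => -x)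
    (fun x _ y _ hxy => neg_le_neg hxy)
  rwa [image_neg_Icc_neg] at h

theorem rightLim_comp_neg {D : ℝ → ℝ} {a b : ℝ} (hab : a < b)
    (hD : BoundedVariationOn (fun x => D (-x)) (Icc (-b) (-a))) :
    Function.rightLim (fun x => D (-x)) (-b) = Function.leftLim D b := by
  have h1 := tendsto_rightLim_of_boundedVariationOn (neg_lt_neg hab) hD
  have h2 := h1.comp (tendsto_neg_nhdsLT (a := b))
  refine (leftLim_eq_of_tendsto (h2.congr fun x => ?_)).symm
  simp

/-- Reflection turns a right-sided Caputo derivative into a left-sided fractional integral. -/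
theorem isBVRep_comp_neg {k : ℕ} {μ θ : ℝ} {u D : ℝ → ℝ}
    (hD : IsBVRep D (caputoRight k μ θ u) (-1) θ) :
    IsBVRep (fun x => D (-x))
      (rlIntegralLeft (k - μ) (-θ) fun y => (-1) ^ k * derivOn k u (-y)) (-θ) 1 := by
  refine ⟨?_, ?_⟩
  · have h1 := hD.1
    rw [Filter.EventuallyEq, ae_restrict_iff' measurableSet_Icc] at h1 ⊢
    have h2 := (Measure.measurePreserving_neg (volume : Measure ℝ)).quasiMeasurePreserving.ae h1
    filter_upwards [h2] with y hy hy'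
    rw [hy ⟨by linarith [hy'.2], by linarith [hy'.1]⟩, caputoRight, rlIntegralRight,
      rlIntegralLeft]
    have h3 := intervalIntegral.integral_comp_neg (a := -θ) (b := y)
      fun z => derivOn k u z / (z - -y) ^ (1 - ((k : ℝ) - μ))
    rw [neg_neg] at h3
    rw [← h3, ← mul_assoc, mul_comm ((-1) ^ k), mul_assoc, ← intervalIntegral.integral_const_mul]
    congr 2
    ext z
    rw [show -z - -y = y - z by ring]
    ring
  · have h := eVariationOn_comp_neg D (-1) θ
    rw [neg_neg] at h
    rw [BoundedVariationOn, h]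
    exact hD.2

/-- Fractional integration by parts on `[θ, 1]`, and on `[-1, θ]` after the reflection `x ↦ -x`. -/
theorem abs_integral_mul_legendreP_le_fracSeminorm {k : ℕ} (hk : 1 ≤ k) {u : ℝ → ℝ}
    (hu : ACDerivs k u) {μ θ : ℝ} (hμ0 : 0 ≤ μ) (hμk : μ < k) (hθ : θ ∈ Ioo (-1 : ℝ) 1)
    {Dm Dp : ℝ → ℝ} (hDm : IsBVRep Dm (caputoRight k μ θ u) (-1) θ)
    (hDp : IsBVRep Dp (caputoLeft k μ θ u) θ 1) {n : ℕ} (hn : k ≤ n) {M : ℝ}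
    (hM : ∀ t ∈ Icc (0 : ℝ) 2, |fracPoly (μ + 1) (legendreT n) t| ≤ M) :
    |∫ x in (-1 : ℝ)..1, u x * (legendreP n).eval x| ≤ M * fracSeminorm Dm Dp θ := by
  have hf := intervalIntegrable_derivOn hk hu
  have hρ : 0 < (k : ℝ) - μ := by linarith
  have hW : Continuous fun x : ℝ => fracPoly k (legendreT n) (1 - x) :=
    (continuous_fracPoly k.cast_nonneg _).comp (continuous_const.sub continuous_id)
  have hsub1 : uIcc (-1) θ ⊆ uIcc (-1 : ℝ) 1 := by
    rw [uIcc_of_le hθ.1.le, uIcc_of_le (by norm_num)]; exact Icc_subset_Icc_right hθ.2.le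
  have hsub2 : uIcc θ 1 ⊆ uIcc (-1 : ℝ) 1 := by
    rw [uIcc_of_le hθ.2.le, uIcc_of_le (by norm_num)]; exact Icc_subset_Icc_left hθ.1.le
  have hf1 := hf.mono_set hsub1
  have hf2 := hf.mono_set hsub2
  have hkμ : μ + ((k : ℝ) - μ) = k := by ring
  have hright := abs_integral_mul_fracPoly_le hθ hρ hμ0 (legendreT n) hf2 hDp hM
  have hf1' : IntervalIntegrable (fun y => (-1) ^ k * derivOn k u (-y)) volume (-θ) 1 := by
    have h := (hf1.comp_sub_left 0).symm
    simp only [zero_sub, neg_neg] at h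
    exact h.const_mul _
  have hDm' := isBVRep_comp_neg hDm
  have hleft := abs_integral_mul_fracPoly_le
    ⟨by linarith [hθ.2], by linarith [hθ.1]⟩ hρ hμ0 (legendreT n) hf1' hDm' hM
  rw [hkμ] at hright hleft
  have hvar : totalVar (fun x => Dm (-x)) (-θ) 1 = totalVar Dm (-1) θ := by
    have h := eVariationOn_comp_neg Dm (-1) θ
    rw [neg_neg] at h
    rw [totalVar, totalVar, h]
  have hlim : Function.rightLim (fun x => Dm (-x)) (-θ) = Function.leftLim Dm θ :=
    rightLim_comp_neg hθ.1 (by rw [neg_neg]; exact hDm'.2)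
  have hflip : ∫ x in (-1)..θ, derivOn k u x * fracPoly k (legendreT n) (1 - x) =
      (-1) ^ n * ∫ y in (-θ)..1, (-1) ^ k * derivOn k u (-y) *
        fracPoly k (legendreT n) (1 - y) := by
    have h := intervalIntegral.integral_comp_neg (a := -θ) (b := 1)
      fun x => derivOn k u x * fracPoly k (legendreT n) (1 - x)
    rw [neg_neg] at h
    rw [← h, ← intervalIntegral.integral_const_mul]
    refine intervalIntegral.integral_congr fun y hy => ?_
    rw [uIcc_of_le (by linarith [hθ.1])] at hy
    have h4 := fracPoly_legendreT_one_add hn (x := y) ⟨by linarith [hy.1, hθ.2], hy.2⟩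
    rw [← sub_neg_eq_add] at h4
    rw [h4, pow_add]
    ring
  rw [integral_mul_legendreP_eq_integral_fracPoly hu hn,
    ← intervalIntegral.integral_add_adjacent_intervals (hf1.mul_continuousOn hW.continuousOn)
      (hf2.mul_continuousOn hW.continuousOn), hflip]
  refine (abs_add_le _ _).trans ?_
  rw [abs_mul, abs_pow, abs_neg, abs_one, one_pow, one_mul]
  rw [hvar, hlim] at hleft
  refine (add_le_add hleft hright).trans_eq ?_
  rw [fracSeminorm]
  ring

/-- The kernel has mean zero because `n ≥ k + 1`, so that `u^{(k)}` may be replaced by `v - v(-1)`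
and no boundary value of `v` appears. -/
theorem abs_integral_mul_legendreP_le_totalVar {k : ℕ} {u v : ℝ → ℝ}
    (hu : ACDerivs k u) (hv : IsBVRep v (derivOn k u) (-1) 1) {n : ℕ} (hn : k + 1 ≤ n) {M : ℝ}
    (hM : ∀ t ∈ Icc (0 : ℝ) 2, |fracPoly ((k : ℝ) + 1) (legendreT n) t| ≤ M) :
    |∫ x in (-1 : ℝ)..1, u x * (legendreP n).eval x| ≤ M * totalVar v (-1) 1 := by
  have hW : Continuous fun x : ℝ => fracPoly k (legendreT n) (1 - x) :=
    (continuous_fracPoly k.cast_nonneg _).comp (continuous_const.sub continuous_id)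
  have h0 : ∫ x in (-1 : ℝ)..1, fracPoly k (legendreT n) (1 - x) = 0 := by
    have h := fracPoly_natCast_legendreT hn (by norm_num : (-1 : ℝ) ≤ 1)
    rw [eval_legendreAntideriv_of_sq_eq_one (by omega) hn (by norm_num), mul_zero,
      Nat.cast_succ] at h
    rw [integral_fracPoly_one_sub k.cast_nonneg (by norm_num), h]
  have hvi := hv.2.intervalIntegrable (by norm_num : (-1 : ℝ) ≤ 1)
  have h1 : ∫ x in (-1 : ℝ)..1, derivOn k u x * fracPoly k (legendreT n) (1 - x) =
      ∫ x in (-1 : ℝ)..1, (v x - v (-1)) * fracPoly k (legendreT n) (1 - x) := by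
    have h2 : ∫ x in (-1 : ℝ)..1, (v x - v (-1)) * fracPoly k (legendreT n) (1 - x) =
        (∫ x in (-1 : ℝ)..1, v x * fracPoly k (legendreT n) (1 - x)) -
          v (-1) * ∫ x in (-1 : ℝ)..1, fracPoly k (legendreT n) (1 - x) := by
      rw [← intervalIntegral.integral_const_mul, ← intervalIntegral.integral_sub
        (hvi.mul_continuousOn hW.continuousOn) ((hW.intervalIntegrable _ _).const_mul _)]
      refine intervalIntegral.integral_congr fun x _ => ?_
      ring
    rw [h2, h0, mul_zero, sub_zero]
    refine intervalIntegral.integral_congr_ae_restrict ?_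
    rw [uIoc_of_le (by norm_num)]
    filter_upwards [ae_mono (Measure.restrict_mono Ioc_subset_Icc_self le_rfl) hv.1] with x hx
    rw [hx]
  rw [integral_mul_legendreP_eq_integral_fracPoly hu (by omega), h1]
  refine abs_integral_sub_mul_le_totalVar (by norm_num) hv.2 hW.continuousOn fun c hc => ?_
  rw [integral_fracPoly_one_sub k.cast_nonneg hc.2]
  exact hM _ ⟨by linarith [hc.2], by linarith [hc.1]⟩

/-- The bound for `|û_n|` per unit of the seminorm of `u`. -/
noncomputable def coeffBound (μ : ℝ) (n : ℕ) : ℝ :=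
  ((n : ℝ) + 1 / 2) * (√(2 / (n + (μ + 1))) * legendreAmp n (μ + 1))

theorem abs_fracPoly_legendreT_le {μ : ℝ} {n : ℕ} (hμ : 0 ≤ μ) (hn : μ < n) {t : ℝ}
    (ht : t ∈ Icc (0 : ℝ) 2) :
    |fracPoly (μ + 1) (legendreT n) t| ≤ √(2 / (n + (μ + 1))) * legendreAmp n (μ + 1) := by
  have h1 := legendreAmp_pos (n := n) (by linarith : 0 ≤ μ + 1) (by linarith)
  refine abs_le_of_sq_le_sq ?_ (by positivity)
  rw [mul_pow, Real.sq_sqrt (by positivity)]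
  exact sq_fracPoly_legendreT_le (by linarith) (by linarith) ht

theorem abs_legendreCoeff_le {u : ℝ → ℝ} {μ U : ℝ} {n : ℕ}
    (h : |∫ x in (-1 : ℝ)..1, u x * (legendreP n).eval x| ≤
      √(2 / (n + (μ + 1))) * legendreAmp n (μ + 1) * U) :
    |legendreCoeff u n| ≤ coeffBound μ n * U := by
  rw [legendreCoeff, abs_mul, abs_of_nonneg (by positivity), coeffBound,
    show (2 * (n : ℝ) + 1) / 2 = n + 1 / 2 by ring, mul_assoc]
  exact mul_le_mul_of_nonneg_left h (by positivity)

end CoefficientBounds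

/-! ### Summation of the tail and convergence rates -/

section TailSums

/-- `Γ(y) / Γ(y + δ)`. -/
noncomputable def gammaQuot (δ y : ℝ) : ℝ := Real.Gamma y / Real.Gamma (y + δ)

theorem gammaQuot_pos {δ y : ℝ} (hδ : 0 < δ) (hy : 0 < y) : 0 < gammaQuot δ y :=
  div_pos (Real.Gamma_pos_of_pos hy) (Real.Gamma_pos_of_pos (by linarith))

theorem gammaQuot_add_half_le {δ y : ℝ} (hδ : 0 < δ) (hy : 0 < y) :
    gammaQuot δ (y + 1 / 2) ≤ gammaQuot δ y := by
  have h := Gamma_add_mul_Gamma_add_le hy hδ (by norm_num : (0 : ℝ) < 1 / 2)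
  rw [gammaQuot, gammaQuot, div_le_div_iff₀ (Real.Gamma_pos_of_pos (by linarith))
    (Real.Gamma_pos_of_pos (by linarith)), show y + 1 / 2 + δ = y + δ + 1 / 2 by ring]
  exact h

theorem gammaQuot_sub {δ y : ℝ} (hδ : 0 < δ) (hy : 0 < y) :
    gammaQuot δ y - gammaQuot δ (y + 1) = δ * (Real.Gamma y / Real.Gamma (y + 1 + δ)) := by
  have h1 := Real.Gamma_pos_of_pos (by linarith : 0 < y + δ)
  have h2 : 0 < y + δ := by linarith
  rw [gammaQuot, gammaQuot, Real.Gamma_add_one hy.ne', show y + 1 + δ = y + δ + 1 by ring,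
    Real.Gamma_add_one h2.ne']
  field_simp
  ring

/-- Telescoping in steps of two bounds the partial sums of a series of Gamma quotients. -/
theorem sum_Gamma_div_Gamma_le {δ y : ℝ} (hδ : 0 < δ) (hy : 0 < y) (r : ℕ) :
    ∑ i ∈ Finset.range r,
      Real.Gamma (y + (i : ℝ) / 2) / Real.Gamma (y + (i : ℝ) / 2 + 1 + δ) ≤
      2 / δ * gammaQuot δ y := by
  have hpos : ∀ i : ℕ, 0 < y + (i : ℝ) / 2 := fun i => by positivity
  have key : δ * ∑ i ∈ Finset.range r,
      Real.Gamma (y + (i : ℝ) / 2) / Real.Gamma (y + (i : ℝ) / 2 + 1 + δ) =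
      gammaQuot δ y + gammaQuot δ (y + 1 / 2) -
        (gammaQuot δ (y + (r : ℝ) / 2) + gammaQuot δ (y + (r : ℝ) / 2 + 1 / 2)) := by
    induction r with
    | zero => simp
    | succ r ih =>
      rw [Finset.sum_range_succ, mul_add, ih, ← gammaQuot_sub hδ (hpos r), Nat.cast_succ,
        show y + ((r : ℝ) + 1) / 2 = y + (r : ℝ) / 2 + 1 / 2 by ring,
        show y + (r : ℝ) / 2 + 1 / 2 + 1 / 2 = y + (r : ℝ) / 2 + 1 by ring]
      ring
  have h1 := gammaQuot_pos hδ (hpos r)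
  have h2 := gammaQuot_pos hδ (by linarith [hpos r] : 0 < y + (r : ℝ) / 2 + 1 / 2)
  have h3 := gammaQuot_add_half_le hδ hy
  rw [div_mul_eq_mul_div, le_div_iff₀ hδ, mul_comm _ δ, key]
  linarith

theorem legendreAmp_add_one (μ : ℝ) (n : ℕ) : legendreAmp n (μ + 1) =
    2 ^ (-μ) / (2 * √Real.pi) *
      (Real.Gamma (((n : ℝ) - μ) / 2) / Real.Gamma (((n : ℝ) + μ + 2) / 2)) := by
  rw [legendreAmp, show (n : ℝ) + 1 - (μ + 1) = n - μ by ring,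
    show (n : ℝ) + (μ + 1) + 1 = n + μ + 2 by ring, neg_add, ← sub_eq_add_neg,
    Real.rpow_sub_one two_ne_zero]
  ring

theorem coeffBound_nonneg {μ : ℝ} {n : ℕ} (hμ : 0 ≤ μ) (hn : μ < n) : 0 ≤ coeffBound μ n := by
  have h1 := legendreAmp_pos (n := n) (by linarith : 0 ≤ μ + 1) (by linarith)
  unfold coeffBound
  positivity

/-- The hypothesis `1/2 < μ` enters through `(n + 1/2)² ≤ (n + μ) (n + μ + 1)`. -/
theorem coeffBound_le {μ : ℝ} {n : ℕ} (hμ : 1 / 2 < μ) (hn : μ < n) :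
    coeffBound μ n ≤ 2 ^ (-μ) / √Real.pi *
      (Real.Gamma (((n : ℝ) - μ) / 2) / Real.Gamma (((n : ℝ) + μ + 1) / 2)) := by
  set z : ℝ := ((n : ℝ) + μ + 1) / 2 with hz
  have hn0 : (0 : ℝ) ≤ n := n.cast_nonneg
  have hz0 : 1 / 2 < z := by rw [hz]; linarith
  have h1 := Real.Gamma_pos_of_pos (by linarith : 0 < ((n : ℝ) - μ) / 2)
  have h2 := Real.Gamma_pos_of_pos (by linarith : 0 < z)
  have h3 := Real.Gamma_pos_of_pos (by linarith : 0 < z + 1 / 2)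
  have h4 := mul_sq_Gamma_le_sq_Gamma_add_half hz0
  have hpi : 0 < √Real.pi := Real.sqrt_pos.2 Real.pi_pos
  have hamp := legendreAmp_add_one μ n
  rw [show ((n : ℝ) + μ + 2) / 2 = z + 1 / 2 by rw [hz]; ring] at hamp
  have h5 : ((n : ℝ) + 1 / 2) * √(2 / (n + (μ + 1))) * Real.Gamma z ≤
      2 * Real.Gamma (z + 1 / 2) := by
    refine le_of_abs_le (abs_le_of_sq_le_sq ?_ (by positivity))
    rw [mul_pow, mul_pow, Real.sq_sqrt (by positivity), mul_pow]
    have h6 : ((n : ℝ) + 1 / 2) ^ 2 * (2 / (n + (μ + 1))) ≤ 2 ^ 2 * (z - 1 / 2) := by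
      rw [mul_div_assoc', div_le_iff₀ (by linarith), hz]
      nlinarith
    calc _ ≤ 2 ^ 2 * (z - 1 / 2) * Real.Gamma z ^ 2 := by gcongr
      _ ≤ _ := by rw [mul_assoc]; gcongr
  calc coeffBound μ n
      = 2 ^ (-μ) / (2 * √Real.pi) * Real.Gamma (((n : ℝ) - μ) / 2) / Real.Gamma (z + 1 / 2) /
          Real.Gamma z * (((n : ℝ) + 1 / 2) * √(2 / (n + (μ + 1))) * Real.Gamma z) := by
        rw [coeffBound, hamp]; field_simp
    _ ≤ 2 ^ (-μ) / (2 * √Real.pi) * Real.Gamma (((n : ℝ) - μ) / 2) / Real.Gamma (z + 1 / 2) /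
          Real.Gamma z * (2 * Real.Gamma (z + 1 / 2)) := by gcongr
    _ = _ := by field_simp

theorem weight_sq {x : ℝ} (hx : x ∈ Ioo (-1 : ℝ) 1) :
    ((1 - x ^ 2) ^ (1 / 4 : ℝ)) ^ 2 = √(1 - x ^ 2) := by
  have hc : 0 < 1 - x ^ 2 := by nlinarith [hx.1, hx.2]
  rw [← Real.rpow_natCast, ← Real.rpow_mul hc.le, Real.sqrt_eq_rpow]
  norm_num

/-- The weighted terms gain a factor `n^{-1/2}` from Bernstein's inequality. -/
theorem coeffBound_mul_weighted_legendreP_le {μ : ℝ} {n : ℕ} (hμ : 0 ≤ μ) (hn : μ < n) {x : ℝ}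
    (hx : x ∈ Ioo (-1 : ℝ) 1) :
    coeffBound μ n * ((1 - x ^ 2) ^ (1 / 4 : ℝ) * |(legendreP n).eval x|) ≤
      2 ^ (-μ) / Real.pi *
        (Real.Gamma (((n : ℝ) - μ) / 2) / Real.Gamma (((n : ℝ) + μ + 2) / 2)) := by
  have hn1 : 1 ≤ n := by
    have : (0 : ℝ) < n := lt_of_le_of_lt hμ hn
    exact_mod_cast this
  have hpi : 0 < √Real.pi := Real.sqrt_pos.2 Real.pi_pos
  have hpi0 := Real.pi_pos
  have hpi2 : √Real.pi ^ 2 = Real.pi := Real.sq_sqrt Real.pi_pos.le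
  have hamp := legendreAmp_add_one μ n
  have hK := legendreAmp_pos (n := n) (by linarith : 0 ≤ μ + 1) (by linarith)
  have hrhs : 2 ^ (-μ) / Real.pi *
      (Real.Gamma (((n : ℝ) - μ) / 2) / Real.Gamma (((n : ℝ) + μ + 2) / 2)) =
      2 / √Real.pi * legendreAmp n (μ + 1) := by
    rw [hamp]; field_simp; rw [hpi2, mul_comm]
  rw [hrhs]
  refine le_of_abs_le (abs_le_of_sq_le_sq ?_ (by positivity))
  have hb := sqrt_mul_sq_legendreP_le hn1 hx
  rw [coeffBound, mul_pow, mul_pow, mul_pow, mul_pow, mul_pow, weight_sq hx, sq_abs,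
    Real.sq_sqrt (by positivity), div_pow, hpi2]
  calc _ ≤ ((n : ℝ) + 1 / 2) ^ 2 * (2 / (n + (μ + 1)) * legendreAmp n (μ + 1) ^ 2) *
        (2 / Real.pi * ((n + 1) / ((n : ℝ) + 1 / 2) ^ 2)) := by gcongr
    _ = 2 ^ 2 / Real.pi * legendreAmp n (μ + 1) ^ 2 * ((n + 1) / (n + (μ + 1))) := by
        field_simp
    _ ≤ 2 ^ 2 / Real.pi * legendreAmp n (μ + 1) ^ 2 * 1 := by
        gcongr
        rw [div_le_one (by positivity)]
        linarith
    _ = _ := by ring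

theorem legendreProj_sub_legendreProj {M N : ℕ} (h : N ≤ M) (u : ℝ → ℝ) (x : ℝ) :
    legendreProj M u x - legendreProj N u x = ∑ i ∈ Finset.range (M - N),
      legendreCoeff u (N + 1 + i) * (legendreP (N + 1 + i)).eval x := by
  obtain ⟨r, rfl⟩ := Nat.exists_eq_add_of_le h
  rw [legendreProj, legendreProj, show N + r + 1 = N + 1 + r by ring, Finset.sum_range_add,
    Nat.add_sub_cancel_left]
  ring

theorem truncConst_eq {μ : ℝ} (hμ : 1 / 2 < μ) (N : ℕ) :
    truncConst μ N = 2 ^ (-μ) / √Real.pi *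
      (2 / (μ - 1 / 2) * gammaQuot (μ - 1 / 2) (((N : ℝ) - μ + 1) / 2)) := by
  have hpi : 0 < √Real.pi := Real.sqrt_pos.2 Real.pi_pos
  have h1 : 0 < μ - 1 / 2 := by linarith
  rw [truncConst, gammaQuot, show ((N : ℝ) - μ + 1) / 2 + (μ - 1 / 2) = (N + μ) / 2 by ring,
    Real.rpow_sub_one two_ne_zero, Real.rpow_neg two_pos.le]
  obtain ⟨d, hd⟩ : ∃ d, d = μ - 1 / 2 := ⟨_, rfl⟩
  rw [← hd] at h1 ⊢
  field_simp

theorem weightedTruncConst_eq {μ : ℝ} (hμ : 0 < μ) (N : ℕ) :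
    weightedTruncConst μ N = 2 ^ (-μ) / Real.pi *
      (2 / μ * gammaQuot μ (((N : ℝ) - μ + 1) / 2)) := by
  have hpi := Real.pi_pos
  rw [weightedTruncConst, gammaQuot, show ((N : ℝ) - μ + 1) / 2 + μ = (N + μ + 1) / 2 by ring,
    Real.rpow_sub_one two_ne_zero, Real.rpow_neg two_pos.le]
  field_simp

theorem truncConst_nonneg {μ : ℝ} {N : ℕ} (hμ : 1 / 2 < μ) (hN : μ ≤ N) :
    0 ≤ truncConst μ N := by
  have h := gammaQuot_pos (by linarith : 0 < μ - 1 / 2)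
    (by linarith : 0 < ((N : ℝ) - μ + 1) / 2)
  have h1 : 0 < μ - 1 / 2 := by linarith
  rw [truncConst_eq hμ]
  positivity

theorem weightedTruncConst_nonneg {μ : ℝ} {N : ℕ} (hμ : 0 < μ) (hN : μ ≤ N) :
    0 ≤ weightedTruncConst μ N := by
  have h := gammaQuot_pos hμ (by linarith : 0 < ((N : ℝ) - μ + 1) / 2)
  rw [weightedTruncConst_eq hμ]
  positivity

/-- A bound for the terms of the weighted tail by Gamma quotients sums up to a bound for the
weighted projection error. -/
theorem ae_weighted_projError_le_of_terms {u ω : ℝ → ℝ} (hu : ContinuousOn u (Icc (-1) 1))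
    (hω : Continuous ω) (hω0 : ∀ x, 0 ≤ ω x) (hω1 : ∀ x, ω x ≤ 1) {μ δ B U : ℝ} (hδ : 0 < δ)
    (hB : 0 ≤ B) (hU : 0 ≤ U) {N : ℕ} (hN : μ ≤ N)
    (hterm : ∀ n : ℕ, μ < n → ∀ x ∈ Ioo (-1 : ℝ) 1,
      ω x * |legendreCoeff u n * (legendreP n).eval x| ≤ B *
        (Real.Gamma (((n : ℝ) - μ) / 2) / Real.Gamma (((n : ℝ) - μ) / 2 + 1 + δ)) * U) :
    ∀ᵐ x ∂volume.restrict (Ioo (-1 : ℝ) 1),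
      ω x * |projError N u x| ≤ B * (2 / δ * gammaQuot δ (((N : ℝ) - μ + 1) / 2)) * U := by
  refine ae_weighted_projError_le hu hω hω0 hω1 fun M hM x hx => ?_
  rw [legendreProj_sub_legendreProj hM]
  calc ω x * |∑ i ∈ Finset.range (M - N),
        legendreCoeff u (N + 1 + i) * (legendreP (N + 1 + i)).eval x|
      ≤ ω x * ∑ i ∈ Finset.range (M - N),
        |legendreCoeff u (N + 1 + i) * (legendreP (N + 1 + i)).eval x| :=
        mul_le_mul_of_nonneg_left (Finset.abs_sum_le_sum_abs _ _) (hω0 x)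
    _ ≤ ∑ i ∈ Finset.range (M - N), B * (Real.Gamma (((N : ℝ) - μ + 1) / 2 + (i : ℝ) / 2) /
          Real.Gamma (((N : ℝ) - μ + 1) / 2 + (i : ℝ) / 2 + 1 + δ)) * U := by
        rw [Finset.mul_sum]
        refine Finset.sum_le_sum fun i _ => ?_
        have h := hterm (N + 1 + i) (by push_cast; linarith [i.cast_nonneg (α := ℝ)]) x hx
        rwa [show (((N + 1 + i : ℕ) : ℝ) - μ) / 2 = ((N : ℝ) - μ + 1) / 2 + (i : ℝ) / 2 by
          push_cast; ring] at h
    _ ≤ _ := by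
        rw [← Finset.sum_mul, ← Finset.mul_sum]
        gcongr
        exact sum_Gamma_div_Gamma_le hδ (by linarith) _

theorem supNorm_le_of_ae {f : ℝ → ℝ} {S : ℝ}
    (h : ∀ᵐ x ∂volume.restrict (Ioo (-1 : ℝ) 1), |f x| ≤ S) :
    supNorm f ≤ ENNReal.ofReal S := by
  rw [supNorm, eLpNorm_exponent_top]
  exact eLpNormEssSup_le_of_ae_bound h

theorem supNorm_projError_le {u : ℝ → ℝ} (hu : ContinuousOn u (Icc (-1) 1)) {μ U : ℝ}
    (hμ : 1 / 2 < μ) (hU : 0 ≤ U)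
    (hcoef : ∀ n : ℕ, μ < n → |legendreCoeff u n| ≤ coeffBound μ n * U) {N : ℕ} (hN : μ ≤ N) :
    supNorm (projError N u) ≤ ENNReal.ofReal (truncConst μ N * U) := by
  have hpi : 0 < √Real.pi := Real.sqrt_pos.2 Real.pi_pos
  have h := ae_weighted_projError_le_of_terms (ω := fun _ => 1) (B := 2 ^ (-μ) / √Real.pi) hu
    continuous_const (fun _ => zero_le_one) (fun _ => le_rfl) (by linarith : 0 < μ - 1 / 2)
    (by positivity) hU hN fun n hn x hx => ?_
  · refine supNorm_le_of_ae ?_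
    rw [truncConst_eq hμ]
    simpa only [one_mul] using h
  · rw [one_mul, abs_mul, show ((n : ℝ) - μ) / 2 + 1 + (μ - 1 / 2) = (n + μ + 1) / 2 by ring]
    have h1 := coeffBound_le hμ hn
    have h2 := abs_eval_legendreP_le_one n (Ioo_subset_Icc_self hx)
    calc _ ≤ coeffBound μ n * U * 1 := mul_le_mul (hcoef n hn) h2 (abs_nonneg _)
            (mul_nonneg (coeffBound_nonneg (by linarith) hn) hU)
      _ ≤ _ := by rw [mul_one]; exact mul_le_mul_of_nonneg_right h1 hU

theorem supNorm_weightedProjError_le {u : ℝ → ℝ} (hu : ContinuousOn u (Icc (-1) 1)) {μ U : ℝ}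
    (hμ : 0 < μ) (hU : 0 ≤ U)
    (hcoef : ∀ n : ℕ, μ < n → |legendreCoeff u n| ≤ coeffBound μ n * U) {N : ℕ} (hN : μ ≤ N) :
    supNorm (weightedProjError N u) ≤ ENNReal.ofReal (weightedTruncConst μ N * U) := by
  have hpi := Real.pi_pos
  -- Outside `[-1, 1]` the weight has to be replaced by a function with values in `[0, 1]`.
  set ω : ℝ → ℝ := fun x => max (1 - x ^ 2) 0 ^ (1 / 4 : ℝ) with hω
  have hωx : ∀ x ∈ Ioo (-1 : ℝ) 1, ω x = (1 - x ^ 2) ^ (1 / 4 : ℝ) := by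
    intro x hx
    simp only [hω]
    rw [max_eq_left (by nlinarith [hx.1, hx.2])]
  have h := ae_weighted_projError_le_of_terms (ω := ω) (B := 2 ^ (-μ) / Real.pi) hu
    (by
      refine Continuous.rpow_const (by fun_prop) fun x => Or.inr (by norm_num))
    (fun x => by positivity)
    (fun x => Real.rpow_le_one (le_max_right _ _)
      (max_le (by linarith [sq_nonneg x]) zero_le_one) (by norm_num)) hμ
    (by positivity) hU hN fun n hn x hx => ?_
  · refine supNorm_le_of_ae ?_
    rw [weightedTruncConst_eq hμ]
    filter_upwards [h, ae_restrict_mem measurableSet_Ioo] with x hx hxI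
    have h1 : 0 ≤ (1 - x ^ 2) ^ (1 / 4 : ℝ) := by
      rw [← hωx x hxI]; positivity
    rwa [weightedProjError, abs_mul, abs_of_nonneg h1, ← hωx x hxI]
  · rw [abs_mul, hωx x hx, show ((n : ℝ) - μ) / 2 + 1 + μ = (n + μ + 2) / 2 by ring]
    have h1 := coeffBound_mul_weighted_legendreP_le hμ.le hn hx
    have h2 : 0 ≤ (1 - x ^ 2) ^ (1 / 4 : ℝ) := by rw [← hωx x hx]; positivity
    calc _ ≤ (1 - x ^ 2) ^ (1 / 4 : ℝ) * (coeffBound μ n * U * |(legendreP n).eval x|) := by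
            gcongr
            exact hcoef n hn
      _ = coeffBound μ n * ((1 - x ^ 2) ^ (1 / 4 : ℝ) * |(legendreP n).eval x|) * U := by ring
      _ ≤ _ := mul_le_mul_of_nonneg_right h1 hU

/-- The quotient decays like `N^{-δ}` along an arithmetic progression. -/
theorem isBigO_gammaQuot {δ : ℝ} (hδ : 0 < δ) (μ : ℝ) :
    (fun N : ℕ => gammaQuot δ (((N : ℝ) - μ + 1) / 2)) =O[atTop]
      fun N : ℕ => (N : ℝ) ^ (-δ) := by
  refine IsBigO.of_bound (4 ^ δ) ?_
  filter_upwards [eventually_ge_atTop (⌈2 * μ + 2⌉₊ + 1)] with N hN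
  have h1 : 2 * μ + 2 ≤ N :=
    (Nat.le_ceil _).trans (by exact_mod_cast (Nat.le_succ _).trans hN)
  have h2 : (1 : ℝ) ≤ N := by exact_mod_cast (by omega : 1 ≤ N)
  have hN4 : 0 < (N : ℝ) / 4 := by positivity
  have h3 : (N : ℝ) / 4 ≤ ((N : ℝ) - μ + 1) / 2 - 1 := by linarith
  have h4 : 1 < ((N : ℝ) - μ + 1) / 2 := by linarith
  have h5 := Gamma_mul_rpow_le_Gamma_add h4 hδ
  have h6 := gammaQuot_pos hδ (by linarith : 0 < ((N : ℝ) - μ + 1) / 2)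
  have h7 := Real.Gamma_pos_of_pos (by linarith : 0 < ((N : ℝ) - μ + 1) / 2)
  rw [Real.norm_of_nonneg h6.le, Real.norm_of_nonneg (by positivity), gammaQuot,
    div_le_iff₀ (Real.Gamma_pos_of_pos (by linarith))]
  have h8 : 4 ^ δ * (N : ℝ) ^ (-δ) = ((N : ℝ) / 4) ^ (-δ) := by
    rw [Real.div_rpow (by linarith) (by norm_num), Real.rpow_neg (by norm_num : (0 : ℝ) ≤ 4)]
    field_simp
  have h9 : ((N : ℝ) / 4) ^ δ ≤ (((N : ℝ) - μ + 1) / 2 - 1) ^ δ :=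
    Real.rpow_le_rpow hN4.le h3 hδ.le
  rw [h8, Real.rpow_neg hN4.le]
  have h10 : 0 < ((N : ℝ) / 4) ^ δ := by positivity
  rw [← div_eq_inv_mul, le_div_iff₀ h10]
  exact (mul_le_mul_of_nonneg_left h9 h7.le).trans h5

theorem isBigO_truncConst {μ : ℝ} (hμ : 1 / 2 < μ) :
    (fun N : ℕ => truncConst μ N) =O[atTop] fun N : ℕ => (N : ℝ) ^ (-μ + 1 / 2) := by
  rw [show -μ + 1 / 2 = -(μ - 1 / 2) by ring]
  simp only [truncConst_eq hμ]
  exact ((isBigO_gammaQuot (by linarith) μ).const_mul_left _).const_mul_left _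

theorem isBigO_weightedTruncConst {μ : ℝ} (hμ : 0 < μ) :
    (fun N : ℕ => weightedTruncConst μ N) =O[atTop] fun N : ℕ => (N : ℝ) ^ (-μ) := by
  simp only [weightedTruncConst_eq hμ]
  exact ((isBigO_gammaQuot hμ μ).const_mul_left _).const_mul_left _

theorem isBigO_toReal_of_le_ofReal {e : ℕ → ℝ≥0∞} {c g : ℕ → ℝ} {μ U : ℝ} (hU : 0 ≤ U)
    (hc : ∀ N : ℕ, μ ≤ N → 0 ≤ c N)
    (he : ∀ N : ℕ, μ ≤ N → e N ≤ ENNReal.ofReal (c N * U)) (hg : c =O[atTop] g) :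
    (fun N => (e N).toReal) =O[atTop] g := by
  refine IsBigO.trans (IsBigO.of_bound U ?_) hg
  filter_upwards [eventually_ge_atTop ⌈μ⌉₊] with N hN
  have h1 : μ ≤ N := (Nat.le_ceil μ).trans (by exact_mod_cast hN)
  rw [Real.norm_of_nonneg ENNReal.toReal_nonneg, Real.norm_of_nonneg (hc N h1), mul_comm]
  exact ENNReal.toReal_le_of_le_ofReal (mul_nonneg (hc N h1) hU) (he N h1)

end TailSums

theorem fracSeminorm_nonneg (Dm Dp : ℝ → ℝ) (θ : ℝ) : 0 ≤ fracSeminorm Dm Dp θ := by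
  unfold fracSeminorm totalVar
  positivity

theorem mainTheorem3 (k : ℕ) (hk : 1 ≤ k) (u : ℝ → ℝ) (hu : ACDerivs k u) :
    (∀ μ θ : ℝ, (k : ℝ) - 1 < μ → μ < k → θ ∈ Ioo (-1 : ℝ) 1 →
      ∀ Dm Dp : ℝ → ℝ,
        IsBVRep Dm (caputoRight k μ θ u) (-1) θ →
        IsBVRep Dp (caputoLeft k μ θ u) θ 1 →
        (1 / 2 < μ → ∀ N : ℕ, μ ≤ N →
          supNorm (projError N u) ≤ ENNReal.ofReal (truncConst μ N * fracSeminorm Dm Dp θ)) ∧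
        (∀ N : ℕ, μ ≤ N →
          supNorm (weightedProjError N u) ≤
            ENNReal.ofReal (weightedTruncConst μ N * fracSeminorm Dm Dp θ)) ∧
        (1 / 2 < μ →
          (fun N : ℕ => truncConst μ N) =O[atTop] (fun N : ℕ => (N : ℝ) ^ (-μ + 1 / 2)) ∧
          (fun N : ℕ => (supNorm (projError N u)).toReal) =O[atTop]
            (fun N : ℕ => (N : ℝ) ^ (-μ + 1 / 2))) ∧
        (fun N : ℕ => weightedTruncConst μ N) =O[atTop] (fun N : ℕ => (N : ℝ) ^ (-μ)) ∧
        (fun N : ℕ => (supNorm (weightedProjError N u)).toReal) =O[atTop]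
          (fun N : ℕ => (N : ℝ) ^ (-μ))) ∧
    (∀ v : ℝ → ℝ, IsBVRep v (derivOn k u) (-1) 1 →
        (∀ N : ℕ, k ≤ N →
          supNorm (projError N u) ≤ ENNReal.ofReal (truncConst k N * totalVar v (-1) 1)) ∧
        (∀ N : ℕ, k ≤ N →
          supNorm (weightedProjError N u) ≤
            ENNReal.ofReal (weightedTruncConst k N * totalVar v (-1) 1)) ∧
        (fun N : ℕ => truncConst k N) =O[atTop] (fun N : ℕ => (N : ℝ) ^ (-(k : ℝ) + 1 / 2)) ∧
        (fun N : ℕ => (supNorm (projError N u)).toReal) =O[atTop]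
          (fun N : ℕ => (N : ℝ) ^ (-(k : ℝ) + 1 / 2)) ∧
        (fun N : ℕ => weightedTruncConst k N) =O[atTop] (fun N : ℕ => (N : ℝ) ^ (-(k : ℝ))) ∧
        (fun N : ℕ => (supNorm (weightedProjError N u)).toReal) =O[atTop]
          (fun N : ℕ => (N : ℝ) ^ (-(k : ℝ)))) := by
  have hcont := continuousOn_of_ACDerivs hk hu
  have hk1 : (1 : ℝ) ≤ k := by exact_mod_cast hk
  refine ⟨fun μ θ hkμ hμk hθ Dm Dp hDm hDp => ?_, fun v hv => ?_⟩
  · have hμ : 0 < μ := by linarith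
    have hU := fracSeminorm_nonneg Dm Dp θ
    have hcoef : ∀ n : ℕ, μ < n →
        |legendreCoeff u n| ≤ coeffBound μ n * fracSeminorm Dm Dp θ := by
      intro n hn
      have hkn : k ≤ n := by
        have h : (k : ℝ) < n + 1 := by linarith
        exact Nat.lt_succ_iff.1 (by exact_mod_cast h)
      exact abs_legendreCoeff_le (abs_integral_mul_legendreP_le_fracSeminorm hk hu hμ.le hμk hθ
        hDm hDp hkn fun t ht => abs_fracPoly_legendreT_le hμ.le hn ht)
    have h1 : 1 / 2 < μ → ∀ N : ℕ, μ ≤ N → supNorm (projError N u) ≤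
        ENNReal.ofReal (truncConst μ N * fracSeminorm Dm Dp θ) :=
      fun h N hN => supNorm_projError_le hcont h hU hcoef hN
    have h2 : ∀ N : ℕ, μ ≤ N → supNorm (weightedProjError N u) ≤
        ENNReal.ofReal (weightedTruncConst μ N * fracSeminorm Dm Dp θ) :=
      fun N hN => supNorm_weightedProjError_le hcont hμ hU hcoef hN
    exact ⟨h1, h2, fun h => ⟨isBigO_truncConst h, isBigO_toReal_of_le_ofReal hU
      (fun N hN => truncConst_nonneg h hN) (h1 h) (isBigO_truncConst h)⟩,
      isBigO_weightedTruncConst hμ, isBigO_toReal_of_le_ofReal hU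
      (fun N hN => weightedTruncConst_nonneg hμ hN) h2 (isBigO_weightedTruncConst hμ)⟩
  · have hμ : 0 < (k : ℝ) := by linarith
    have hμ' : 1 / 2 < (k : ℝ) := by linarith
    have hU : 0 ≤ totalVar v (-1) 1 := ENNReal.toReal_nonneg
    have hcoef : ∀ n : ℕ, (k : ℝ) < n →
        |legendreCoeff u n| ≤ coeffBound k n * totalVar v (-1) 1 := by
      intro n hn
      exact abs_legendreCoeff_le (abs_integral_mul_legendreP_le_totalVar hu hv
        (by exact_mod_cast hn) fun t ht => abs_fracPoly_legendreT_le hμ.le hn ht)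
    have h1 : ∀ N : ℕ, (k : ℝ) ≤ N → supNorm (projError N u) ≤
        ENNReal.ofReal (truncConst k N * totalVar v (-1) 1) :=
      fun N hN => supNorm_projError_le hcont hμ' hU hcoef hN
    have h2 : ∀ N : ℕ, (k : ℝ) ≤ N → supNorm (weightedProjError N u) ≤
        ENNReal.ofReal (weightedTruncConst k N * totalVar v (-1) 1) :=
      fun N hN => supNorm_weightedProjError_le hcont hμ hU hcoef hN
    exact ⟨fun N hN => h1 N (by exact_mod_cast hN), fun N hN => h2 N (by exact_mod_cast hN),
      isBigO_truncConst hμ', isBigO_toReal_of_le_ofReal hU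
      (fun N hN => truncConst_nonneg hμ' hN) h1 (isBigO_truncConst hμ'),
      isBigO_weightedTruncConst hμ, isBigO_toReal_of_le_ofReal hU
      (fun N hN => weightedTruncConst_nonneg hμ hN) h2 (isBigO_weightedTruncConst hμ)⟩
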